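/- **Theorem (regret of the federated lifelong bandit optimizer F-LiBO).** *Setting.* Let $\mathcal X\subset\mathbb R^{d_0}$ be compact, let $\phi_j:\mathcal X\to\mathbb R^{d_j}$ ($j=1,\dots,p$) be measurable feature maps, $k_j(x,x')=\phi_j(x)^\top\phi_j(x')\le 1$, and for $J\subset\{1,\dots,p\}$ write $k_J=\frac1{|J|}\sum_{j\in J}k_j$ (with $k_\emptyset=0$). The true kernel is $k^\star=k_{J^\star}$ for an unknown $J^\star$. There are $m$ clients (tasks) with rewards $f_s=\sum_j\phi_j^\top\beta_s^{(j)}$, $\beta_s^{(j)}=0$ for $j\notin J^\star$, such that $f_s$ lies in the RKHS $\mathcal H_{k^\star}$ and $\|f_s\|_{k^\star}\le B$, $B>0$. Playing $x_{s,i}$ in step $i\le n$ of task $s$ yields $y_{s,i}=f_s(x_{s,i})+\varepsilon_{s,i}$, where the $\varepsilon_{s,i}$ are independent, centred and satisfy $\mathbb P(|\varepsilon_{s,i}|\ge t)\le 2e^{-t^2/(2\sigma^2)}$ for $t\ge0$. The lifelong regret is $R(m,n)=\sum_{s=1}^m\sum_{i=1}^n\big(\sup_{\mathcal X} f_s-f_s(x_{s,i})\big)$.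 *Algorithm.* BaseBO is an arbitrary (possibly randomized) rule that maps a kernel and the data of the current task to the next action. Fix $\alpha\in(0,1)$, $0<\omega<c_1$, $c_\kappa>0$, $\bar\omega=\min\{\omega,c_1-\omega\}$, $\lambda=\bar\omega c_\kappa^2/8$ and $n_s=\lfloor\sqrt n\rfloor$. In its first $n_s$ steps client $s$ plays random exploration points; jointly over all clients these are independent of the noise (for example, i.i.d. uniform on $\mathcal X$). From its exploration data it computes a minimizer $\hat\beta_s$ of $\frac1{n_s}\sum_{i\le n_s}\big(y_{s,i}-\sum_j\phi_j(x_{s,i})^\top b^{(j)}\big)^2+\lambda\sum_j\|b^{(j)}\|_2$ and reports $\hat J_s^{(\mathrm{client})}=\{j:\|\hat\beta_s^{(j)}\|_2>\omega\}$. After $r$ reports the server holds $\hat k_r=k_{\hat J_r}$, where $\hat J_r=\{j:\#\{s\le r: j\in\hat J_s^{(\mathrm{client})}\}\ge r\alpha\}$; in particular $\hat k_0=k_{\{1,\dots,p\}}$. In the steps $i>n_s$ of task $s$, BaseBO chooses the actions with the kernel $\hat k_s$, from all data of the task so far. (The vote $\hat k_s$ needs only the exploration data of the clients $1,\dots,s$.)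 *Assumptions.* Let $0<\delta<1$. 1. $\|\beta_s^{(j)}\|_2\ge c_1$ for all $s\le m$ and $j\in J^\star$. 2. With probability at least $1-\delta/4$, $\kappa(\Phi_s)\ge c_\kappa$ for all $s\le m$, where $\Phi_s$ is the $n_s$-row feature matrix of the exploration points of client $s$ and $\kappa(\Phi)=\inf\frac{1}{\sqrt{n_s}}\frac{\|\Phi b\|_2}{\sum_{j\in J}\|b^{(j)}\|_2}$ over all $|J|\le|J^\star|$ and $b\ne0$ with $\sum_{j\notin J}\|b^{(j)}\|_2\le3\sum_{j\in J}\|b^{(j)}\|_2$ ($\inf\emptyset=\infty$). 3. (Worst-case oracle regret $R^\star=R^\star(m,n)$.) For all rewards in the $B$-ball of $\mathcal H_{k^\star}$, with probability at least $1-\delta/2$, BaseBO has total regret at most $R^\star$ over the steps $i>n_s$ of the $m$ tasks when it is given $k^\star$ in place of the estimated kernel (with the same exploration data). *Conclusion.* There are constants $C,N_0>0$ that depend only on $\sigma,\alpha,c_\kappa,c_1,\omega$ such that, whenever $\sqrt n\ge N_0(1+\log p)$ (with the convention $\log 0=0$), with probability greater than $1-\delta$, $$R(m,n)-R^\star(m,n)\le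 C\Big(Bm\sqrt n+B\sqrt n\,\log\frac{mp}{\delta}\Big).$$ If instead client $s$ uses $\hat k_{s-1}$, the vote of the earlier clients only (so that the first client uses the average of all base kernels), the same holds with the additional term $2Bn$ on the right. Consequently, for fixed $m,p,B,\delta$, the first bound on $R(m,n)$ is $o(n)$ whenever $R^\star(m,n)=o(n)$; but for fixed $n\ge1$ the excess bound divided by $m$ does not tend to $0$ as $m\to\infty$, so the bound does not give oracle optimality. -/

import Mathlib

open MeasureTheory ProbabilityTheory Filter Topology Asymptotics

namespace FLiBO

noncomputable section

/-! ### Base kernels, linear rewards, RKHS balls -/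

/-- Block vectors `b = (b⁽¹⁾, …, b⁽ᵖ⁾)` with `b⁽ʲ⁾ ∈ ℝ^{d j}` (Euclidean norm on every block). -/
abbrev Coeff {p : ℕ} (d : Fin p → ℕ) : Type :=
  (j : Fin p) → EuclideanSpace ℝ (Fin (d j))

/-- Feature maps `φ j : X → ℝ^{d j}` of the `p` base kernels. -/
abbrev FeatureMaps (X : Type) {p : ℕ} (d : Fin p → ℕ) : Type :=
  (j : Fin p) → X → EuclideanSpace ℝ (Fin (d j))

variable {X : Type} {p : ℕ} {d : Fin p → ℕ}

/-- The base kernel `k_j(x, x') = φ_j(x)ᵀ φ_j(x')`. -/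
def baseKernel (φ : FeatureMaps X d) (j : Fin p) (x x' : X) : ℝ :=
  inner ℝ (φ j x) (φ j x')

/-- The average `(1 / |J|) ∑_{j ∈ J} k_j` of the base kernels in `J`. -/
def avgKernel (φ : FeatureMaps X d) (J : Finset (Fin p)) (x x' : X) : ℝ :=
  (1 / (J.card : ℝ)) * ∑ j ∈ J, baseKernel φ j x x'

/-- The function `x ↦ ∑_j φ_j(x)ᵀ b⁽ʲ⁾`. -/
def linearReward (φ : FeatureMaps X d) (b : Coeff d) (x : X) : ℝ :=
  ∑ j, inner ℝ (φ j x) (b j)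

/-- A real kernel as a matrix of operators on `ℝ`, the form in which Mathlib's reproducing kernel
Hilbert spaces take it. -/
def kernelMatrix (k : X → X → ℝ) : Matrix X X (ℝ →L[ℝ] ℝ) :=
  Matrix.of fun x x' => k x x' • ContinuousLinearMap.id ℝ ℝ

/-- `f ∈ 𝓗_k` and `‖f‖_k ≤ B`, where `𝓗_k` is the reproducing kernel Hilbert space of `k`. -/
def InRKHSBall (k : X → X → ℝ) (B : ℝ) (f : X → ℝ) : Prop :=
  ∃ h : (kernelMatrix k).PosSemidef,
    haveI : Fact (kernelMatrix k).PosSemidef := ⟨h⟩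
    ∃ g : RKHS.OfKernel (kernelMatrix k), (∀ x, g x = f x) ∧ ‖g‖ ≤ B

/-! ### The group lasso, the compatibility variable, thresholding and voting -/

/-- The local group lasso loss
`(1/N) ∑_i (y_i - ∑_j φ_j(x_i)ᵀ b⁽ʲ⁾)² + lam ∑_j ‖b⁽ʲ⁾‖₂` of a data set of size `N`. -/
def lassoLoss (φ : FeatureMaps X d) (lam : ℝ) {N : ℕ} (D : Fin N → X × ℝ) (b : Coeff d) : ℝ :=
  (1 / (N : ℝ)) * ∑ i, ((D i).2 - linearReward φ b (D i).1) ^ 2 + lam * ∑ j, ‖b j‖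

/-- The compatibility variable `κ(Φ)` of the feature matrix `Φ` of the points `x_1, …, x_N`:
the infimum of `N^{-1/2} ‖Φ b‖₂ / ∑_{j ∈ J} ‖b⁽ʲ⁾‖₂` over `|J| ≤ r` and `b ≠ 0` with
`∑_{j ∉ J} ‖b⁽ʲ⁾‖₂ ≤ 3 ∑_{j ∈ J} ‖b⁽ʲ⁾‖₂` (equal to `∞` if there are no such `J`, `b`). -/
def compatibility (φ : FeatureMaps X d) (r : ℕ) {N : ℕ} (x : Fin N → X) : ENNReal :=
  ⨅ (J : Finset (Fin p)) (_ : J.card ≤ r) (b : Coeff d) (_ : b ≠ 0)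
    (_ : ∑ j ∈ Jᶜ, ‖b j‖ ≤ 3 * ∑ j ∈ J, ‖b j‖),
    ENNReal.ofReal ((1 / √(N : ℝ)) * √(∑ i, linearReward φ b (x i) ^ 2) / ∑ j ∈ J, ‖b j‖)

open Classical in
/-- The support that a client reports: `{ j | ‖b⁽ʲ⁾‖₂ > thr }`. -/
def thresholdSupport (thr : ℝ) (b : Coeff d) : Finset (Fin p) :=
  Finset.univ.filter fun j => thr < ‖b j‖

open Classical in
/-- The server's `α`-majority vote over the first `r` clients (clients are numbered from `0`):
`{ j | #{ s < r | j ∈ J s } ≥ r α }`. -/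
def voteSupport {m : ℕ} (α : ℝ) (J : Fin m → Finset (Fin p)) (r : ℕ) : Finset (Fin p) :=
  Finset.univ.filter fun j =>
    (r : ℝ) * α ≤ ((Finset.univ.filter fun s : Fin m => s.val < r ∧ j ∈ J s).card : ℝ)

/-- Before any client has voted, the server's kernel is the average of all base kernels. -/
theorem voteSupport_zero {m : ℕ} (α : ℝ) (J : Fin m → Finset (Fin p)) :
    voteSupport α J 0 = Finset.univ := by
  simp [voteSupport]

/-! ### Interaction with the tasks -/

/-- A base bandit algorithm: from the kernel it is given, its internal random seed and the data
`(x_1, y_1), …, (x_{i-1}, y_{i-1})` of the current task it computes the next action `x_i`. -/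
abbrev BaseAlgorithm (X S : Type*) := (X → X → ℝ) → S → List (X × ℝ) → X

section Task

variable {n nexp : ℕ}

/-- The data of the first `i` steps of one task with reward `f` and noise `e`: the first `nexp`
actions are the forced exploration actions `v`, afterwards `next` chooses an action on the basis of
all the data of the task so far. -/
def taskData (f : X → ℝ) (next : List (X × ℝ) → X) (v : Fin nexp → X) (e : Fin n → ℝ) :
    (i : ℕ) → i ≤ n → List (X × ℝ)
  | 0, _ => []
  | i + 1, hi =>
    let D := taskData f next v e i (Nat.le_of_succ_le hi)
    let x := if h : i < nexp then v ⟨i, h⟩ else next D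
    D ++ [(x, f x + e ⟨i, hi⟩)]

/-- The action in step `i` (steps are numbered from `0`) of one task. -/
def taskAction (f : X → ℝ) (next : List (X × ℝ) → X) (v : Fin nexp → X) (e : Fin n → ℝ)
    (i : Fin n) : X :=
  if h : i.val < nexp then v ⟨i.val, h⟩ else next (taskData f next v e i.val i.isLt.le)

end Task

section Lifelong

variable {S : Type*} {m n nexp : ℕ}

/-- The actions in `m` tasks with rewards `f s`, if in task `s` the base algorithm, given the kernel
`K s`, takes over after `nexp` steps of forced exploration. -/
def lifelongActions (base : BaseAlgorithm X S) (f : Fin m → X → ℝ) (K : Fin m → X → X → ℝ)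
    (U : Fin m → S) (V : Fin m → Fin nexp → X) (E : Fin m → Fin n → ℝ) (s : Fin m) (i : Fin n) : X :=
  taskAction (f s) (base (K s) (U s)) (V s) (E s) i

/-- The lifelong regret `∑_s ∑_i (max f_s - f_s(x_{s,i}))`. -/
def lifelongRegret (f : Fin m → X → ℝ) (x : Fin m → Fin n → X) : ℝ :=
  ∑ s, ∑ i, ((⨆ z, f s z) - f s (x s i))

/-- The regret of the base algorithm with oracle knowledge of the kernel `kstar`, over the steps in
which the base algorithm chooses the action. -/
def oracleRegret (base : BaseAlgorithm X S) (kstar : X → X → ℝ) (f : Fin m → X → ℝ)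
    (U : Fin m → S) (V : Fin m → Fin nexp → X) (E : Fin m → Fin n → ℝ) : ℝ :=
  ∑ s, ∑ i ∈ Finset.univ.filter (fun i : Fin n => nexp ≤ i.val),
    ((⨆ z, f s z) - f s (lifelongActions base f (fun _ => kstar) U V E s i))

/-- The forced exploration data of client `s`. -/
def explorationData (h : nexp ≤ n) (f : Fin m → X → ℝ) (V : Fin m → Fin nexp → X)
    (E : Fin m → Fin n → ℝ) (s : Fin m) (i : Fin nexp) : X × ℝ :=
  (V s i, f s (V s i) + E s (Fin.castLE h i))

/-- The server's kernel after the vote of the first `r` clients, each of which reports the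
thresholded support of its own local group lasso solution. -/
def serverKernel (φ : FeatureMaps X d) (solve : (Fin nexp → X × ℝ) → Coeff d) (thr α : ℝ)
    (h : nexp ≤ n) (f : Fin m → X → ℝ) (V : Fin m → Fin nexp → X) (E : Fin m → Fin n → ℝ)
    (r : ℕ) : X → X → ℝ :=
  avgKernel φ
    (voteSupport α (fun s => thresholdSupport thr (solve (explorationData h f V E s))) r)

/-- The lifelong regret of the federated lifelong bandit optimizer, if client `s` runs the base
algorithm with the server's kernel after the vote of the first `votes s` clients. -/
def fliboRegret (base : BaseAlgorithm X S) (φ : FeatureMaps X d)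
    (solve : (Fin nexp → X × ℝ) → Coeff d) (thr α : ℝ) (h : nexp ≤ n) (votes : Fin m → ℕ)
    (f : Fin m → X → ℝ) (U : Fin m → S) (V : Fin m → Fin nexp → X) (E : Fin m → Fin n → ℝ) : ℝ :=
  lifelongRegret f
    (lifelongActions base f (fun s => serverKernel φ solve thr α h f V E (votes s)) U V E)

end Lifelong

/-! ### Probability -/

section Prob

variable {Ω : Type*} [MeasurableSpace Ω]

/-- `P` holds with probability at least `q`. -/
def ProbAtLeast (μ : Measure Ω) (q : ℝ) (P : Ω → Prop) : Prop :=
  ∃ A : Set Ω, MeasurableSet A ∧ q ≤ μ.real A ∧ ∀ ω ∈ A, P ω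

/-- `P` holds with probability greater than `q`. -/
def ProbGreater (μ : Measure Ω) (q : ℝ) (P : Ω → Prop) : Prop :=
  ∃ A : Set Ω, MeasurableSet A ∧ q < μ.real A ∧ ∀ ω ∈ A, P ω

/-- A centred random variable with the tail bound `ℙ(|Y| ≥ t) ≤ 2 exp(-t² / (2 σ²))`. -/
structure IsSubGaussian (σ : ℝ) (Y : Ω → ℝ) (μ : Measure Ω) : Prop where
  aemeasurable : AEMeasurable Y μ
  mean_zero : ∫ ω, Y ω ∂μ = 0
  tail : ∀ t : ℝ, 0 ≤ t → μ.real {ω | t ≤ |Y ω|} ≤ 2 * Real.exp (-t ^ 2 / (2 * σ ^ 2))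

/-- With probability at least `q`, the base algorithm with oracle knowledge of the kernel `kstar`
has regret at most `R`; this is a worst-case guarantee, for all rewards in the ball of radius `B` of
the reproducing kernel Hilbert space of `kstar`. -/
def HasOracleRegret {S : Type*} {m n nexp : ℕ} (base : BaseAlgorithm X S) (kstar : X → X → ℝ)
    (B q R : ℝ) (U : Fin m → Ω → S) (V : Fin m → Fin nexp → Ω → X) (E : Fin m → Fin n → Ω → ℝ)
    (μ : Measure Ω) : Prop :=
  ∀ f : Fin m → X → ℝ, (∀ s, InRKHSBall kstar B (f s)) →
    ProbAtLeast μ q fun ω =>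
      oracleRegret base kstar f (fun s => U s ω) (fun s i => V s i ω) (fun s i => E s i ω) ≤ R

end Prob

/-- `B m √n + B √n log(m p / δ)`. -/
def excessRate (B δ : ℝ) (m n p : ℕ) : ℝ :=
  B * m * √(n : ℝ) + B * √(n : ℝ) * Real.log ((m : ℝ) * p / δ)

end

end FLiBO

namespace FLiBO

/-! Call a client noisy if its exploration noise correlates strongly with some feature map. Under
the compatibility condition the group lasso of a client that is not noisy has total block error at
most `6 * lam / c ^ 2`, which is three quarters of `min thr (c₁ - thr)`. Thresholding therefore
returns the true support exactly (`thresholdSupport_eq_of_lassoLoss_le`), and a vote is correct as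
soon as at most a fraction `min α (1 - α) / 2` of the voters is noisy
(`voteSupport_eq_of_few_errors`).

A dimension-free tail bound for sums `∑ Y i • v i` (`measure_lt_norm_sum_smul_le`) makes a client
noisy with probability at most `exp (-a)`, where `a` is of order √n once √n dominates 1 + log p.
With the exploration points frozen, distinct clients depend on disjoint blocks of independent noise.
Many noisy clients among the earliest r thus have probability exponentially small in r√n, because a
union bound over sets of voters costs only 2^r (`measure_exists_many_blocks_le`). Summing over r ≥
r₀, all votes of at least r₀ clients are correct simultaneously, with r₀ = 1 + ⌊O(log(8/δ)/√n)⌋.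

With the correct kernel, and the same seed, points and noise, the optimizer plays exactly the
oracle's actions (`lifelongRegret_le_oracleRegret_add`). The excess regret is at most 2B per
exploration step and 2Bn per task with fewer than r₀ votes. A client that counts its own vote leaves
only r₀ - 1 such tasks, so the rounding in r₀ is free; otherwise one more task is lost, which is the
extra 2Bn. -/

theorem lintegral_Ioi_mul_exp_neg_mul_sq {a c : ℝ} (ha : 0 ≤ a) (hc : 0 < c) :
    ∫⁻ t in Set.Ioi (0 : ℝ), ENNReal.ofReal (a * t * Real.exp (-c * t ^ 2)) =
      ENNReal.ofReal (a / (2 * c)) := by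
  have hd : ∀ t : ℝ, HasDerivAt (fun t => -(a / (2 * c)) * Real.exp (-c * t ^ 2))
      (a * t * Real.exp (-c * t ^ 2)) t := by
    intro t
    have h := ((((hasDerivAt_pow 2 t).const_mul (-c)).exp).const_mul (-(a / (2 * c))))
    convert! h using 1
    field_simp
    ring
  have hlim : Tendsto (fun t : ℝ => -(a / (2 * c)) * Real.exp (-c * t ^ 2)) atTop (𝓝 0) := by
    have h1 : Tendsto (fun t : ℝ => c * t ^ 2) atTop atTop :=
      (tendsto_pow_atTop two_ne_zero).const_mul_atTop hc
    have h2 := (Real.tendsto_exp_neg_atTop_nhds_zero.comp h1).const_mul (-(a / (2 * c)))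
    simpa [Function.comp_def, neg_mul] using h2
  have hnn : ∀ t ∈ Set.Ioi (0 : ℝ), 0 ≤ a * t * Real.exp (-c * t ^ 2) := fun t ht =>
    mul_nonneg (mul_nonneg ha (le_of_lt ht)) (Real.exp_nonneg _)
  have hint := integrableOn_Ioi_deriv_of_nonneg' (fun t _ => hd t) hnn hlim
  have hval := integral_Ioi_of_hasDerivAt_of_nonneg' (fun t _ => hd t) hnn hlim
  rw [← ofReal_integral_eq_lintegral_ofReal hint
    ((ae_restrict_iff' measurableSet_Ioi).2 (ae_of_all _ hnn)), hval]
  simp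

/-! ### Exponential moments of one sub-Gaussian variable, derived from its tail bound. -/

section Scalar

variable {Ω : Type*} [MeasurableSpace Ω] {μ : Measure Ω} [IsProbabilityMeasure μ] {σ : ℝ}
  {Y : Ω → ℝ}

/-- Layer-cake formula with the tail bound: the factor `exp (b t²)` uses up at most half of the
Gaussian decay, so the tail integral is at most `2 b / c` with `c ≥ 1 / (4 σ²)`. -/
theorem IsSubGaussian.lintegral_exp_mul_sq_le (hY : IsSubGaussian σ Y μ) (hσ : 0 < σ) {b : ℝ}
    (hb : 0 ≤ b) (hb' : b ≤ 1 / (4 * σ ^ 2)) :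
    ∫⁻ ω, ENNReal.ofReal (Real.exp (b * Y ω ^ 2)) ∂μ ≤
      ENNReal.ofReal (Real.exp (8 * σ ^ 2 * b)) := by
  have hσ2 : 0 < σ ^ 2 := by positivity
  set c : ℝ := 1 / (2 * σ ^ 2) - b with hc
  have hc' : 1 / (4 * σ ^ 2) ≤ c := by
    have : 1 / (2 * σ ^ 2) = 1 / (4 * σ ^ 2) + 1 / (4 * σ ^ 2) := by field_simp; norm_num
    rw [hc, this]; linarith
  have hc0 : 0 < c := lt_of_lt_of_le (by positivity) hc'
  have hprim : ∀ y : ℝ, ∫ t in (0 : ℝ)..y, 2 * b * t * Real.exp (b * t ^ 2) =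
      Real.exp (b * y ^ 2) - 1 := by
    intro y
    have hd : ∀ t ∈ Set.uIcc (0 : ℝ) y, HasDerivAt (fun t => Real.exp (b * t ^ 2))
        (2 * b * t * Real.exp (b * t ^ 2)) t := by
      intro t _
      have h := ((hasDerivAt_pow 2 t).const_mul b).exp
      convert! h using 1
      push_cast
      ring
    rw [intervalIntegral.integral_eq_sub_of_hasDerivAt hd
      (Continuous.intervalIntegrable (by fun_prop) _ _)]
    simp
  have hlc := lintegral_comp_eq_lintegral_meas_le_mul μ (f := fun ω => |Y ω|)
    (g := fun t => 2 * b * t * Real.exp (b * t ^ 2)) (ae_of_all _ fun ω => abs_nonneg _)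
    hY.aemeasurable.abs (fun t _ => Continuous.intervalIntegrable (by fun_prop) _ _)
    ((ae_restrict_iff' measurableSet_Ioi).2 (ae_of_all _ fun t ht => by
      have : (0 : ℝ) < t := ht
      positivity))
  simp only [hprim, sq_abs] at hlc
  calc ∫⁻ ω, ENNReal.ofReal (Real.exp (b * Y ω ^ 2)) ∂μ
      = ∫⁻ ω, (1 + ENNReal.ofReal (Real.exp (b * Y ω ^ 2) - 1)) ∂μ := by
        refine lintegral_congr fun ω => ?_
        have : 1 ≤ Real.exp (b * Y ω ^ 2) := Real.one_le_exp (by positivity)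
        rw [← ENNReal.ofReal_one, ← ENNReal.ofReal_add zero_le_one (by linarith)]
        congr 1; ring
    _ = 1 + ∫⁻ t in Set.Ioi (0 : ℝ), μ {ω | t ≤ |Y ω|} *
          ENNReal.ofReal (2 * b * t * Real.exp (b * t ^ 2)) := by
        rw [lintegral_add_left measurable_const, hlc]; simp
    _ ≤ 1 + ∫⁻ t in Set.Ioi (0 : ℝ), ENNReal.ofReal (4 * b * t * Real.exp (-c * t ^ 2)) := by
        gcongr 1 + ?_
        refine setLIntegral_mono' measurableSet_Ioi fun t ht => ?_
        have ht0 : (0 : ℝ) < t := ht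
        have h1 : μ {ω | t ≤ |Y ω|} ≤
            ENNReal.ofReal (2 * Real.exp (-t ^ 2 / (2 * σ ^ 2))) := by
          rw [← ENNReal.ofReal_toReal (measure_ne_top μ {ω | t ≤ |Y ω|})]
          exact ENNReal.ofReal_le_ofReal (hY.tail t ht0.le)
        refine (mul_le_mul_left h1 _).trans ?_
        rw [← ENNReal.ofReal_mul (by positivity)]
        apply ENNReal.ofReal_le_ofReal
        apply le_of_eq
        have : Real.exp (-c * t ^ 2) =
            Real.exp (-t ^ 2 / (2 * σ ^ 2)) * Real.exp (b * t ^ 2) := by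
          rw [← Real.exp_add, hc]; congr 1; field_simp; ring
        rw [this]; ring
    _ = ENNReal.ofReal (1 + 4 * b / (2 * c)) := by
        rw [lintegral_Ioi_mul_exp_neg_mul_sq (by positivity) hc0,
          ENNReal.ofReal_add zero_le_one (by positivity), ENNReal.ofReal_one]
    _ ≤ ENNReal.ofReal (Real.exp (8 * σ ^ 2 * b)) := by
        apply ENNReal.ofReal_le_ofReal
        have h2 : 4 * b / (2 * c) ≤ 8 * σ ^ 2 * b := by
          rw [div_le_iff₀ (by positivity)]
          have h3 : 1 ≤ c * (4 * σ ^ 2) := by rwa [div_le_iff₀ (by positivity)] at hc'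
          nlinarith
        linarith [Real.add_one_le_exp (8 * σ ^ 2 * b)]

theorem IsSubGaussian.integrable (hY : IsSubGaussian σ Y μ) (hσ : 0 < σ) : Integrable Y μ := by
  have hb : (0 : ℝ) < 1 / (4 * σ ^ 2) := by positivity
  have h := hY.lintegral_exp_mul_sq_le hσ hb.le le_rfl
  have hm := hY.aemeasurable
  have hi : Integrable (fun ω => Real.exp (1 / (4 * σ ^ 2) * Y ω ^ 2)) μ := by
    refine ⟨(by fun_prop : AEMeasurable _ μ).aestronglyMeasurable, ?_⟩
    rw [hasFiniteIntegral_iff_ofReal (ae_of_all _ fun _ => Real.exp_nonneg _)]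
    exact h.trans_lt ENNReal.ofReal_lt_top
  refine (hi.const_mul (1 + 4 * σ ^ 2)).mono' hm.aestronglyMeasurable (ae_of_all _ fun ω => ?_)
  have h1 := Real.add_one_le_exp (1 / (4 * σ ^ 2) * Y ω ^ 2)
  have h2 : Y ω ^ 2 = (4 * σ ^ 2) * (1 / (4 * σ ^ 2) * Y ω ^ 2) := by field_simp
  have h3 : |Y ω| ≤ 1 + Y ω ^ 2 := by
    rw [← sq_abs]; nlinarith [sq_nonneg (|Y ω| - 1), abs_nonneg (Y ω)]
  rw [Real.norm_eq_abs]
  have h4 : 0 ≤ 1 / (4 * σ ^ 2) * Y ω ^ 2 := by positivity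
  nlinarith [sq_nonneg σ]

/-- The linear term integrates to zero for a centred variable, so the moment bound for `Y²` yields
one for `Y` with no constant in front of the exponential. This matters because such factors are
multiplied over all samples. -/
theorem exp_le_add_exp_sq (x : ℝ) : Real.exp x ≤ x + Real.exp (x ^ 2) := by
  have h2 := Real.add_one_le_exp (x ^ 2)
  rcases le_or_gt |x| 1 with h | h
  · have h1 := (abs_le.1 (Real.abs_exp_sub_one_sub_id_le h)).2
    linarith
  · rcases lt_abs.1 h with h | h
    · have h1 : Real.exp x ≤ Real.exp (x ^ 2) := Real.exp_le_exp.2 (by nlinarith)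
      linarith
    · have h1 : Real.exp x ≤ 1 := Real.exp_le_one_iff.2 (by linarith)
      nlinarith

theorem IsSubGaussian.lintegral_exp_mul_le (hY : IsSubGaussian σ Y μ) (hσ : 0 < σ) (s : ℝ) :
    ∫⁻ ω, ENNReal.ofReal (Real.exp (s * Y ω)) ∂μ ≤
      ENNReal.ofReal (Real.exp (8 * σ ^ 2 * s ^ 2)) := by
  have hm := hY.aemeasurable
  rcases le_or_gt (s ^ 2) (1 / (4 * σ ^ 2)) with hs | hs
  · have h := hY.lintegral_exp_mul_sq_le hσ (sq_nonneg s) hs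
    have hi : Integrable (fun ω => Real.exp (s ^ 2 * Y ω ^ 2)) μ := by
      refine ⟨(by fun_prop : AEMeasurable _ μ).aestronglyMeasurable, ?_⟩
      rw [hasFiniteIntegral_iff_ofReal (ae_of_all _ fun _ => Real.exp_nonneg _)]
      exact h.trans_lt ENNReal.ofReal_lt_top
    have hYi := (hY.integrable hσ).const_mul s
    have hle : ∀ ω, Real.exp (s * Y ω) ≤ s * Y ω + Real.exp (s ^ 2 * Y ω ^ 2) := fun ω => by
      rw [← mul_pow]; exact exp_le_add_exp_sq _
    calc ∫⁻ ω, ENNReal.ofReal (Real.exp (s * Y ω)) ∂μ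
        ≤ ∫⁻ ω, ENNReal.ofReal (s * Y ω + Real.exp (s ^ 2 * Y ω ^ 2)) ∂μ :=
          lintegral_mono fun ω => ENNReal.ofReal_le_ofReal (hle ω)
      _ = ENNReal.ofReal (∫ ω, (s * Y ω + Real.exp (s ^ 2 * Y ω ^ 2)) ∂μ) :=
          (ofReal_integral_eq_lintegral_ofReal (hYi.add hi)
            (ae_of_all _ fun ω => (Real.exp_nonneg _).trans (hle ω))).symm
      _ = ENNReal.ofReal (∫ ω, Real.exp (s ^ 2 * Y ω ^ 2) ∂μ) := by
          rw [integral_add hYi hi, integral_const_mul, hY.mean_zero, mul_zero, zero_add]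
      _ = ∫⁻ ω, ENNReal.ofReal (Real.exp (s ^ 2 * Y ω ^ 2)) ∂μ :=
          ofReal_integral_eq_lintegral_ofReal hi (ae_of_all _ fun _ => Real.exp_nonneg _)
      _ ≤ _ := h
  -- For large `s`, `s Y ≤ 2 σ² s² + Y² / (8 σ²)`; the resulting factor `e` is absorbed because `4
  -- σ² s² > 1`.
  · have hb : (0 : ℝ) ≤ 1 / (8 * σ ^ 2) := by positivity
    have hb' : 1 / (8 * σ ^ 2) ≤ 1 / (4 * σ ^ 2) := by gcongr; norm_num
    have h := hY.lintegral_exp_mul_sq_le hσ hb hb'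
    calc ∫⁻ ω, ENNReal.ofReal (Real.exp (s * Y ω)) ∂μ
        ≤ ∫⁻ ω, ENNReal.ofReal (Real.exp (2 * σ ^ 2 * s ^ 2)) *
            ENNReal.ofReal (Real.exp (1 / (8 * σ ^ 2) * Y ω ^ 2)) ∂μ := by
          refine lintegral_mono fun ω => ?_
          rw [← ENNReal.ofReal_mul (Real.exp_nonneg _), ← Real.exp_add]
          apply ENNReal.ofReal_le_ofReal
          apply Real.exp_le_exp.2
          have : 2 * σ ^ 2 * s ^ 2 + 1 / (8 * σ ^ 2) * Y ω ^ 2 - s * Y ω =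
              1 / (8 * σ ^ 2) * (4 * σ ^ 2 * s - Y ω) ^ 2 := by field_simp; ring
          have : 0 ≤ 1 / (8 * σ ^ 2) * (4 * σ ^ 2 * s - Y ω) ^ 2 := by positivity
          linarith
      _ ≤ ENNReal.ofReal (Real.exp (2 * σ ^ 2 * s ^ 2)) *
            ENNReal.ofReal (Real.exp (8 * σ ^ 2 * (1 / (8 * σ ^ 2)))) := by
          rw [lintegral_const_mul' _ _ ENNReal.ofReal_ne_top]
          gcongr
      _ ≤ _ := by
          rw [← ENNReal.ofReal_mul (Real.exp_nonneg _), ← Real.exp_add]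
          apply ENNReal.ofReal_le_ofReal
          apply Real.exp_le_exp.2
          have h1 : 8 * σ ^ 2 * (1 / (8 * σ ^ 2)) = 1 := by field_simp
          rw [div_lt_iff₀ (by positivity)] at hs
          rw [h1]; nlinarith

theorem IsSubGaussian.lintegral_exp_linear_add_sq_le (hY : IsSubGaussian σ Y μ) (hσ : 0 < σ)
    (s : ℝ) {b : ℝ} (hb : 0 ≤ b) (hb' : b ≤ 1 / (8 * σ ^ 2)) :
    ∫⁻ ω, ENNReal.ofReal (Real.exp (s * Y ω + b * Y ω ^ 2)) ∂μ ≤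
      ENNReal.ofReal (Real.exp (16 * σ ^ 2 * s ^ 2 + 8 * σ ^ 2 * b)) := by
  have hm := hY.aemeasurable
  have h1 := hY.lintegral_exp_mul_le hσ (2 * s)
  have h2 := hY.lintegral_exp_mul_sq_le hσ (b := 2 * b) (by positivity) (by
    calc 2 * b ≤ 2 * (1 / (8 * σ ^ 2)) := by gcongr
      _ = 1 / (4 * σ ^ 2) := by field_simp; norm_num)
  set a₁ := 8 * σ ^ 2 * (2 * s) ^ 2 with ha₁
  set a₂ := 8 * σ ^ 2 * (2 * b) with ha₂
  -- Cauchy–Schwarz in the form of a weighted AM–GM inequality; the weights make both terms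
  -- integrate to at most half of `exp ((a₁ + a₂) / 2)`.
  have key : ∀ x y : ℝ, Real.exp (x + y) ≤
      Real.exp ((a₂ - a₁) / 2) / 2 * Real.exp (2 * x) +
      Real.exp ((a₁ - a₂) / 2) / 2 * Real.exp (2 * y) := by
    intro x y
    have e1 : Real.exp ((a₂ - a₁) / 2) * Real.exp (2 * x) =
        Real.exp ((a₂ - a₁) / 4 + x) ^ 2 := by
      rw [← Real.exp_add, ← Real.exp_nat_mul]; congr 1; push_cast; ring
    have e2 : Real.exp ((a₁ - a₂) / 2) * Real.exp (2 * y) =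
        Real.exp ((a₁ - a₂) / 4 + y) ^ 2 := by
      rw [← Real.exp_add, ← Real.exp_nat_mul]; congr 1; push_cast; ring
    have e3 : Real.exp (x + y) =
        Real.exp ((a₂ - a₁) / 4 + x) * Real.exp ((a₁ - a₂) / 4 + y) := by
      rw [← Real.exp_add]; congr 1; ring
    nlinarith [sq_nonneg (Real.exp ((a₂ - a₁) / 4 + x) - Real.exp ((a₁ - a₂) / 4 + y))]
  calc ∫⁻ ω, ENNReal.ofReal (Real.exp (s * Y ω + b * Y ω ^ 2)) ∂μ
      ≤ ∫⁻ ω, (ENNReal.ofReal (Real.exp ((a₂ - a₁) / 2) / 2) *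
            ENNReal.ofReal (Real.exp (2 * s * Y ω)) +
          ENNReal.ofReal (Real.exp ((a₁ - a₂) / 2) / 2) *
            ENNReal.ofReal (Real.exp (2 * b * Y ω ^ 2))) ∂μ := by
        refine lintegral_mono fun ω => ?_
        rw [← ENNReal.ofReal_mul (by positivity), ← ENNReal.ofReal_mul (by positivity),
          ← ENNReal.ofReal_add (by positivity) (by positivity)]
        apply ENNReal.ofReal_le_ofReal
        have := key (s * Y ω) (b * Y ω ^ 2)
        simpa only [← mul_assoc] using this
    _ ≤ ENNReal.ofReal (Real.exp ((a₂ - a₁) / 2) / 2) * ENNReal.ofReal (Real.exp a₁) +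
          ENNReal.ofReal (Real.exp ((a₁ - a₂) / 2) / 2) * ENNReal.ofReal (Real.exp a₂) := by
        rw [lintegral_add_left' (by fun_prop), lintegral_const_mul' _ _ ENNReal.ofReal_ne_top,
          lintegral_const_mul' _ _ ENNReal.ofReal_ne_top]
        gcongr
    _ = ENNReal.ofReal (Real.exp (16 * σ ^ 2 * s ^ 2 + 8 * σ ^ 2 * b)) := by
        rw [← ENNReal.ofReal_mul (by positivity), ← ENNReal.ofReal_mul (by positivity),
          ← ENNReal.ofReal_add (by positivity) (by positivity), div_mul_eq_mul_div,
          div_mul_eq_mul_div, ← Real.exp_add, ← Real.exp_add]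
        have e1 : (a₂ - a₁) / 2 + a₁ = 16 * σ ^ 2 * s ^ 2 + 8 * σ ^ 2 * b := by
          rw [ha₁, ha₂]; ring
        have e2 : (a₁ - a₂) / 2 + a₂ = 16 * σ ^ 2 * s ^ 2 + 8 * σ ^ 2 * b := by
          rw [ha₁, ha₂]; ring
        rw [e1, e2]; congr 1; ring

end Scalar

/-! ### Dimension-free concentration for norms of random vector sums. -/

section Vector

theorem lintegral_comp_prodMk_of_indepFun {Ω α β : Type*} [MeasurableSpace Ω] {μ : Measure Ω}
    [IsProbabilityMeasure μ] [MeasurableSpace α] [MeasurableSpace β] {X : Ω → α} {Y : Ω → β}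
    (hX : Measurable X) (hY : Measurable Y) (h : IndepFun X Y μ) {F : α × β → ENNReal}
    (hF : Measurable F) :
    ∫⁻ ω, F (X ω, Y ω) ∂μ = ∫⁻ ω, ∫⁻ ω', F (X ω, Y ω') ∂μ ∂μ := by
  have hlaw := (indepFun_iff_map_prod_eq_prod_map_map hX.aemeasurable hY.aemeasurable).1 h
  have := Measure.isProbabilityMeasure_map (μ := μ) hY.aemeasurable
  rw [← lintegral_map hF (hX.prodMk hY), hlaw, lintegral_prod _ hF.aemeasurable,
    lintegral_map hF.lintegral_prod_right' hX]
  refine lintegral_congr fun ω => ?_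
  exact lintegral_map (hF.comp measurable_prodMk_left) hY

variable {Ω : Type*} [MeasurableSpace Ω] {μ : Measure Ω} [IsProbabilityMeasure μ] {σ : ℝ}
  {ι : Type*} {Y : ι → Ω → ℝ} {D : ℕ}

/-- Integrating out one summand keeps the shape `exp (‖z‖² / M)`, at the price of lowering `M` by
`64 σ²` and a factor `exp (1 / (8 L))`. Only the inner product of `z` and `v` enters, so the
dimension `D` plays no role. -/
theorem lintegral_exp_norm_add_smul_sq_le {Y : Ω → ℝ} (hY : IsSubGaussian σ Y μ) (hσ : 0 < σ)
    {L M : ℝ} (hL : 1 ≤ L) (hM : 64 * σ ^ 2 * L < M) (z v : EuclideanSpace ℝ (Fin D)) (hv : ‖v‖ ≤ 1) :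
    ∫⁻ ω, ENNReal.ofReal (Real.exp (‖z + Y ω • v‖ ^ 2 / M)) ∂μ ≤
      ENNReal.ofReal (Real.exp (1 / (8 * L))) *
        ENNReal.ofReal (Real.exp (‖z‖ ^ 2 / (M - 64 * σ ^ 2))) := by
  have hσ2 : 0 < σ ^ 2 := by positivity
  have hM1 : 64 * σ ^ 2 < M := lt_of_le_of_lt (by nlinarith) hM
  have hM0 : 0 < M := lt_trans (by positivity) hM1
  have hv2 : ‖v‖ ^ 2 ≤ 1 := by nlinarith [norm_nonneg v]
  have hiv : (inner ℝ z v) ^ 2 ≤ ‖z‖ ^ 2 := by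
    have h1 := abs_real_inner_le_norm z v
    have h2 : |inner ℝ z v| ≤ ‖z‖ :=
      h1.trans (mul_le_of_le_one_right (norm_nonneg z) hv)
    rw [← sq_abs]
    exact pow_le_pow_left₀ (abs_nonneg _) h2 2
  have hexp : ∀ ω, ENNReal.ofReal (Real.exp (‖z + Y ω • v‖ ^ 2 / M)) =
      ENNReal.ofReal (Real.exp (‖z‖ ^ 2 / M)) * ENNReal.ofReal
        (Real.exp (2 * inner ℝ z v / M * Y ω + ‖v‖ ^ 2 / M * Y ω ^ 2)) := by
    intro ω
    rw [← ENNReal.ofReal_mul (Real.exp_nonneg _), ← Real.exp_add, norm_add_sq_real,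
      inner_smul_right, norm_smul, Real.norm_eq_abs, mul_pow, sq_abs]
    congr 2; ring
  have hb : ‖v‖ ^ 2 / M ≤ 1 / (8 * σ ^ 2) := by
    rw [div_le_div_iff₀ hM0 (by positivity)]
    nlinarith
  simp only [hexp]
  rw [lintegral_const_mul' _ _ ENNReal.ofReal_ne_top]
  refine (mul_le_mul_right (hY.lintegral_exp_linear_add_sq_le hσ _ (by positivity) hb) _).trans ?_
  rw [← ENNReal.ofReal_mul (Real.exp_nonneg _), ← Real.exp_add,
    ← ENNReal.ofReal_mul (Real.exp_nonneg _), ← Real.exp_add]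
  apply ENNReal.ofReal_le_ofReal
  apply Real.exp_le_exp.2
  have hMC : 0 < M - 64 * σ ^ 2 := by linarith
  have h1 : 16 * σ ^ 2 * (2 * inner ℝ z v / M) ^ 2 ≤ 64 * σ ^ 2 * ‖z‖ ^ 2 / M ^ 2 := by
    calc 16 * σ ^ 2 * (2 * inner ℝ z v / M) ^ 2 =
          64 * σ ^ 2 * (inner ℝ z v) ^ 2 / M ^ 2 := by ring
      _ ≤ _ := by gcongr
  have h2 : 8 * σ ^ 2 * (‖v‖ ^ 2 / M) ≤ 1 / (8 * L) := by
    rw [← mul_div_assoc, div_le_div_iff₀ hM0 (by positivity)]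
    have h4 : 8 * σ ^ 2 * ‖v‖ ^ 2 * (8 * L) ≤ 64 * σ ^ 2 * L := by
      have : 0 ≤ 64 * σ ^ 2 * L := by positivity
      nlinarith
    linarith
  -- This is `1 / M + C / M² ≤ 1 / (M - C)` with `C = 64 σ²`.
  have h3 : ‖z‖ ^ 2 / M + 64 * σ ^ 2 * ‖z‖ ^ 2 / M ^ 2 ≤ ‖z‖ ^ 2 / (M - 64 * σ ^ 2) := by
    rw [div_add_div _ _ hM0.ne' (by positivity), div_le_div_iff₀ (by positivity) hMC]
    have : 0 ≤ M * ‖z‖ ^ 2 * (64 * σ ^ 2) ^ 2 := by positivity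
    nlinarith
  linarith

/-- The summands are peeled off one at a time. The budget `64 σ² (s.card + L)` for `M` pays for
every decrement and still leaves `64 σ² L` at the end. -/
theorem lintegral_exp_norm_sum_smul_sq_le (hind : iIndepFun Y μ) (hm : ∀ i, Measurable (Y i))
    (hY : ∀ i, IsSubGaussian σ (Y i) μ) (hσ : 0 < σ) (v : ι → EuclideanSpace ℝ (Fin D))
    (hv : ∀ i, ‖v i‖ ≤ 1) (s : Finset ι) {L M : ℝ} (hL : 1 ≤ L) (hM : 64 * σ ^ 2 * (s.card + L) ≤ M) :
    ∫⁻ ω, ENNReal.ofReal (Real.exp (‖∑ i ∈ s, Y i ω • v i‖ ^ 2 / M)) ∂μ ≤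
      ENNReal.ofReal (Real.exp (s.card * (1 / (8 * L)))) := by
  classical
  induction s using Finset.induction_on generalizing M with
  | empty => simp
  | insert i s hi ih =>
    have hσ2 : 0 < σ ^ 2 := by positivity
    rw [Finset.card_insert_of_notMem hi] at hM ⊢
    push_cast at hM ⊢
    have hc : (0 : ℝ) ≤ s.card := by positivity
    have hW : iIndepFun (fun j ω => Y j ω • v j) μ :=
      hind.comp (fun j (y : ℝ) => y • v j) fun j => by fun_prop
    have hi2 : IndepFun (fun ω => ∑ j ∈ s, Y j ω • v j) (fun ω => Y i ω • v i) μ := by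
      have := hW.indepFun_finsetSum_of_notMem (fun j => (hm j).smul_const _) hi
      convert! this using 1
      ext ω : 1
      simp
    have hF : Measurable fun q : EuclideanSpace ℝ (Fin D) × EuclideanSpace ℝ (Fin D) =>
        ENNReal.ofReal (Real.exp (‖q.1 + q.2‖ ^ 2 / M)) := by fun_prop
    calc ∫⁻ ω, ENNReal.ofReal (Real.exp (‖∑ j ∈ insert i s, Y j ω • v j‖ ^ 2 / M)) ∂μ
        = ∫⁻ ω, ∫⁻ ω', ENNReal.ofReal
            (Real.exp (‖(∑ j ∈ s, Y j ω • v j) + Y i ω' • v i‖ ^ 2 / M)) ∂μ ∂μ := by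
          rw [← lintegral_comp_prodMk_of_indepFun (by fun_prop) (by fun_prop) hi2 hF]
          simp only [Finset.sum_insert hi, add_comm]
      _ ≤ ∫⁻ ω, ENNReal.ofReal (Real.exp (1 / (8 * L))) * ENNReal.ofReal
            (Real.exp (‖∑ j ∈ s, Y j ω • v j‖ ^ 2 / (M - 64 * σ ^ 2))) ∂μ :=
          lintegral_mono fun ω =>
            lintegral_exp_norm_add_smul_sq_le (hY i) hσ hL (by nlinarith) _ _ (hv i)
      _ ≤ ENNReal.ofReal (Real.exp (1 / (8 * L))) * ENNReal.ofReal (Real.exp (s.card * (1 / (8 * L)))) := by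
          rw [lintegral_const_mul' _ _ ENNReal.ofReal_ne_top]
          gcongr
          exact ih (by linarith)
      _ = _ := by
          rw [← ENNReal.ofReal_mul (Real.exp_nonneg _), ← Real.exp_add]
          congr 2; ring

theorem measure_lt_norm_sum_smul_le (hind : iIndepFun Y μ) (hm : ∀ i, Measurable (Y i))
    (hY : ∀ i, IsSubGaussian σ (Y i) μ) (hσ : 0 < σ) (v : ι → EuclideanSpace ℝ (Fin D))
    (hv : ∀ i, ‖v i‖ ≤ 1) (s : Finset ι) (hs : 0 < s.card) {τ : ℝ} (hτ : 0 ≤ τ) :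
    μ {ω | τ * s.card < ‖∑ i ∈ s, Y i ω • v i‖} ≤
      ENNReal.ofReal (Real.exp (1 - τ ^ 2 * s.card / (128 * σ ^ 2))) := by
  have hs' : (1 : ℝ) ≤ s.card := by exact_mod_cast hs
  have hσ2 : 0 < σ ^ 2 := by positivity
  -- Taking `L = s.card` makes the exponential moment at most `exp (1 / 8)`, below the factor `e` in
  -- the claim; Markov's inequality does the rest.
  have h := lintegral_exp_norm_sum_smul_sq_le hind hm hY hσ v hv s
    (M := 128 * σ ^ 2 * s.card) hs' (by nlinarith)
  set a : ℝ := Real.exp (τ ^ 2 * s.card / (128 * σ ^ 2)) with ha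
  have hmk := mul_meas_ge_le_lintegral₀ (μ := μ) (f := fun ω => ENNReal.ofReal
    (Real.exp (‖∑ i ∈ s, Y i ω • v i‖ ^ 2 / (128 * σ ^ 2 * s.card)))) (by fun_prop)
    (ENNReal.ofReal a)
  have hsub : {ω | τ * s.card < ‖∑ i ∈ s, Y i ω • v i‖} ⊆ {ω | ENNReal.ofReal a ≤
      ENNReal.ofReal (Real.exp (‖∑ i ∈ s, Y i ω • v i‖ ^ 2 / (128 * σ ^ 2 * s.card)))} := by
    intro ω hω
    simp only [Set.mem_ofPred_eq] at hω ⊢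
    apply ENNReal.ofReal_le_ofReal
    apply Real.exp_le_exp.2
    have h2 : (τ * s.card) ^ 2 ≤ ‖∑ i ∈ s, Y i ω • v i‖ ^ 2 :=
      pow_le_pow_left₀ (by positivity) hω.le 2
    calc τ ^ 2 * s.card / (128 * σ ^ 2) = (τ * s.card) ^ 2 / (128 * σ ^ 2 * s.card) := by
          field_simp
      _ ≤ _ := by gcongr
  have ha0 : ENNReal.ofReal a ≠ 0 := by simpa using Real.exp_pos _
  refine (measure_mono hsub).trans ?_
  rw [Real.exp_sub, ENNReal.ofReal_div_of_pos (Real.exp_pos _),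
    ENNReal.le_div_iff_mul_le (.inl ha0) (.inl ENNReal.ofReal_ne_top), mul_comm]
  refine (hmk.trans h).trans (ENNReal.ofReal_le_ofReal (Real.exp_le_exp.2 ?_))
  rw [mul_one_div, div_le_one (by positivity)]
  linarith

end Vector

/-! ### Independent blocks of noise and the union bound over sets of clients. -/

section Blocks

variable {Ω : Type*} [MeasurableSpace Ω] {μ : Measure Ω} [IsProbabilityMeasure μ]

theorem measure_forall_block_le {ι κ : Type*} [Fintype κ] {Y : ι × κ → Ω → ℝ}
    (hind : iIndepFun Y μ) (hm : ∀ i, Measurable (Y i)) {B : ι → Set (κ → ℝ)}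
    (hB : ∀ i, MeasurableSet (B i)) {q : ENNReal}
    (hq : ∀ i, μ {ω | (fun k => Y (i, k) ω) ∈ B i} ≤ q) (A : Finset ι) :
    μ {ω | ∀ i ∈ A, (fun k => Y (i, k) ω) ∈ B i} ≤ q ^ A.card := by
  classical
  induction A using Finset.induction_on with
  | empty => simp
  | insert a A ha ih =>
    have hdisj : Disjoint (A ×ˢ (Finset.univ : Finset κ)) ({a} ×ˢ Finset.univ) := by
      rw [Finset.disjoint_left]
      rintro ⟨i, k⟩ h1 h2
      simp only [Finset.mem_product, Finset.mem_singleton, Finset.mem_univ, and_true] at h1 h2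
      exact ha (h2 ▸ h1)
    have hI := hind.indepFun_finset _ _ hdisj hm
    let S : Set (↥(A ×ˢ (Finset.univ : Finset κ)) → ℝ) :=
      {g | ∀ i, ∀ hi : i ∈ A, (fun k => g ⟨(i, k), by simp [hi]⟩) ∈ B i}
    let T : Set (↥({a} ×ˢ (Finset.univ : Finset κ)) → ℝ) :=
      {g | (fun k => g ⟨(a, k), by simp⟩) ∈ B a}
    have hS : MeasurableSet S := by
      have : S = ⋂ i : A, (fun g => fun k => g ⟨(i.1, k), by simp [i.2]⟩) ⁻¹' B i.1 := by
        ext g; simp [S]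
      rw [this]
      exact MeasurableSet.iInter fun i => (hB _).preimage (by fun_prop)
    have hT : MeasurableSet T := (hB a).preimage (by fun_prop)
    have h := hI.measure_inter_preimage_eq_mul S T hS hT
    rw [Finset.card_insert_of_notMem ha, pow_succ]
    calc μ {ω | ∀ i ∈ insert a A, (fun k => Y (i, k) ω) ∈ B i}
        = μ {ω | ∀ i ∈ A, (fun k => Y (i, k) ω) ∈ B i} *
            μ {ω | (fun k => Y (a, k) ω) ∈ B a} := by
          refine Eq.trans ?_ h
          congr 1
          ext ω
          simp [S, T, and_comm]
      _ ≤ _ := mul_le_mul' ih (hq a)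

/-- For each `r` there are at most `2 ^ r` sets `A`, each bad with probability at most `x ^ (2 r)`,
where `x = exp (-(a γ / 2))`. Since `a γ ≥ 2` forces `x ≤ 1 / 2`, the product is at most `x ^ r`,
and the geometric series from `r₀` costs only a factor 2. -/
theorem measure_exists_many_blocks_le {m : ℕ} {κ : Type*} [Fintype κ] {Y : Fin m × κ → Ω → ℝ}
    (hind : iIndepFun Y μ) (hm : ∀ i, Measurable (Y i)) {B : Fin m → Set (κ → ℝ)}
    (hB : ∀ i, MeasurableSet (B i)) {a γ : ℝ} (ha : 0 ≤ a) (haγ : 2 ≤ a * γ)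
    (hq : ∀ i, μ {ω | (fun k => Y (i, k) ω) ∈ B i} ≤ ENNReal.ofReal (Real.exp (-a))) (r₀ : ℕ) :
    μ {ω | ∃ r, r₀ ≤ r ∧ r ≤ m ∧ ∃ A : Finset (Fin m), (∀ s ∈ A, s.val < r) ∧ r * γ < A.card ∧
        ∀ s ∈ A, (fun k => Y (s, k) ω) ∈ B s} ≤
      ENNReal.ofReal (2 * Real.exp (-(a * γ / 2) * r₀)) := by
  classical
  set x : ℝ := Real.exp (-(a * γ / 2)) with hx
  have hx0 : 0 < x := Real.exp_pos _
  have hx2 : x ≤ 1 / 2 := by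
    have h1 : x ≤ Real.exp (-1) := Real.exp_le_exp.2 (by linarith)
    have h2 : (2 : ℝ) ≤ Real.exp 1 := by linarith [Real.add_one_le_exp (1 : ℝ)]
    rw [Real.exp_neg] at h1
    refine h1.trans ?_
    rw [one_div]
    exact inv_anti₀ (by norm_num) h2
  have hone : ∀ r : ℕ, μ {ω | ∃ A : Finset (Fin m), (∀ s ∈ A, s.val < r) ∧ r * γ < A.card ∧
        ∀ s ∈ A, (fun k => Y (s, k) ω) ∈ B s} ≤ ENNReal.ofReal (x ^ r) := by
    intro r
    set F : Finset (Fin m) := Finset.univ.filter fun s => s.val < r with hF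
    have hFc : F.card ≤ r := by
      have : (F.map Fin.valEmbedding).card ≤ (Finset.range r).card := by
        refine Finset.card_le_card fun k hk => ?_
        simp only [hF, Finset.mem_map, Finset.mem_filter] at hk
        obtain ⟨s, hs, rfl⟩ := hk
        simpa using hs
      simpa using this
    set G : Finset (Finset (Fin m)) := F.powerset.filter fun A => r * γ < A.card with hG
    have hGc : (G.card : ℝ) ≤ 2 ^ r := by
      have h1 : G.card ≤ 2 ^ F.card := by
        rw [← Finset.card_powerset]; exact Finset.card_filter_le _ _
      have h2 : 2 ^ F.card ≤ 2 ^ r := Nat.pow_le_pow_right (by norm_num) hFc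
      exact_mod_cast h1.trans h2
    calc _ ≤ μ (⋃ A ∈ G, {ω | ∀ s ∈ A, (fun k => Y (s, k) ω) ∈ B s}) := by
          refine measure_mono fun ω hω => ?_
          obtain ⟨A, h1, h2, h3⟩ := hω
          simp only [Set.mem_iUnion]
          refine ⟨A, ?_, h3⟩
          simp only [hG, hF, Finset.mem_filter, Finset.mem_powerset]
          exact ⟨fun s hs => by simpa using h1 s hs, h2⟩
      _ ≤ ∑ A ∈ G, μ {ω | ∀ s ∈ A, (fun k => Y (s, k) ω) ∈ B s} :=
          measure_biUnion_finset_le _ _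
      _ ≤ ∑ A ∈ G, ENNReal.ofReal (Real.exp (-(a * γ) * r)) := by
          refine Finset.sum_le_sum fun A hA => ?_
          refine (measure_forall_block_le hind hm hB hq A).trans ?_
          rw [← ENNReal.ofReal_pow (Real.exp_nonneg _), ← Real.exp_nat_mul]
          apply ENNReal.ofReal_le_ofReal
          apply Real.exp_le_exp.2
          have h2 := (Finset.mem_filter.1 hA).2
          nlinarith
      _ = ENNReal.ofReal (G.card * Real.exp (-(a * γ) * r)) := by
          rw [Finset.sum_const, nsmul_eq_mul, ENNReal.ofReal_mul (by positivity)]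
          simp
      _ ≤ ENNReal.ofReal (x ^ r) := by
          apply ENNReal.ofReal_le_ofReal
          have e : Real.exp (-(a * γ) * r) = (Real.exp (-(a * γ))) ^ r := by
            rw [← Real.exp_nat_mul]; congr 1; ring
          rw [e]
          refine (mul_le_mul_of_nonneg_right hGc (by positivity)).trans ?_
          rw [← mul_pow]
          refine pow_le_pow_left₀ (by positivity) ?_ r
          have e2 : Real.exp (-(a * γ)) = x * x := by
            rw [hx, ← Real.exp_add]; congr 1; ring
          rw [e2]; nlinarith
  calc _ ≤ μ (⋃ r ∈ Finset.Ico r₀ (m + 1), {ω | ∃ A : Finset (Fin m), (∀ s ∈ A, s.val < r) ∧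
          r * γ < A.card ∧ ∀ s ∈ A, (fun k => Y (s, k) ω) ∈ B s}) := by
        refine measure_mono fun ω hω => ?_
        obtain ⟨r, h1, h2, h3⟩ := hω
        simp only [Set.mem_iUnion]
        exact ⟨r, Finset.mem_Ico.2 ⟨h1, by omega⟩, h3⟩
    _ ≤ ∑ r ∈ Finset.Ico r₀ (m + 1), μ {ω | ∃ A : Finset (Fin m), (∀ s ∈ A, s.val < r) ∧
          r * γ < A.card ∧ ∀ s ∈ A, (fun k => Y (s, k) ω) ∈ B s} :=
        measure_biUnion_finset_le _ _
    _ ≤ ∑ r ∈ Finset.Ico r₀ (m + 1), ENNReal.ofReal (x ^ r) :=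
        Finset.sum_le_sum fun r _ => hone r
    _ = ENNReal.ofReal (∑ r ∈ Finset.Ico r₀ (m + 1), x ^ r) :=
        (ENNReal.ofReal_sum_of_nonneg fun r _ => by positivity).symm
    _ ≤ ENNReal.ofReal (2 * Real.exp (-(a * γ / 2) * r₀)) := by
        apply ENNReal.ofReal_le_ofReal
        refine (geom_sum_Ico_le_of_lt_one hx0.le (by linarith)).trans ?_
        have e : Real.exp (-(a * γ / 2) * r₀) = x ^ r₀ := by
          rw [← Real.exp_nat_mul]; congr 1; ring
        rw [e, div_le_iff₀ (by linarith)]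
        have : 0 < x ^ r₀ := by positivity
        nlinarith

end Blocks

/-! ### Deterministic part: RKHS bounds, group lasso, thresholding, voting and regret comparison. -/

section Deterministic

variable {X : Type} {p : ℕ} {d : Fin p → ℕ} {φ : FeatureMaps X d}

theorem norm_feature_le_one (hk : ∀ j x x', baseKernel φ j x x' ≤ 1) (j : Fin p) (x : X) :
    ‖φ j x‖ ≤ 1 := by
  have h := hk j x x
  rw [baseKernel, real_inner_self_eq_norm_sq] at h
  nlinarith [norm_nonneg (φ j x)]

theorem avgKernel_self_nonneg (J : Finset (Fin p)) (x : X) : 0 ≤ avgKernel φ J x x :=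
  mul_nonneg (by positivity) (Finset.sum_nonneg fun _ _ => real_inner_self_nonneg)

theorem avgKernel_self_le_one (hk : ∀ j x x', baseKernel φ j x x' ≤ 1) (J : Finset (Fin p))
    (x : X) : avgKernel φ J x x ≤ 1 := by
  have h : ∑ j ∈ J, baseKernel φ j x x ≤ J.card := by
    simpa using Finset.sum_le_sum fun j (_ : j ∈ J) => hk j x x
  calc avgKernel φ J x x ≤ 1 / (J.card : ℝ) * J.card := by
        unfold avgKernel; gcongr
    _ ≤ 1 := by rw [one_div]; exact inv_mul_le_one

/-- The reproducing property bounds evaluation at `x` by `‖g‖ √(k x x)`. It bounds the regret of a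
single step by `2 * B`. -/
theorem InRKHSBall.abs_le {k : X → X → ℝ} {B : ℝ} {f : X → ℝ} (hf : InRKHSBall k B f) {x : X}
    (h₀ : 0 ≤ k x x) (h₁ : k x x ≤ 1) : |f x| ≤ B := by
  obtain ⟨hK, g, hg, hB⟩ := hf
  have : Fact (kernelMatrix k).PosSemidef := ⟨hK⟩
  have h := RKHS.norm_apply_le g x
  have hn : ‖kernelMatrix k x x‖ ≤ 1 := by
    have hid : ‖ContinuousLinearMap.id ℝ ℝ‖ = 1 := ContinuousLinearMap.norm_id
    simp only [kernelMatrix, Matrix.of_apply, norm_smul, hid, mul_one, Real.norm_eq_abs]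
    rwa [abs_of_nonneg h₀]
  rw [RKHS.OfKernel.kernel_ofKernel, hg, Real.norm_eq_abs] at h
  have hs : √‖kernelMatrix k x x‖ ≤ 1 := Real.sqrt_le_one.2 hn
  nlinarith [norm_nonneg g]

theorem linearReward_sub (a b : Coeff d) (x : X) :
    linearReward φ (a - b) x = linearReward φ a x - linearReward φ b x := by
  simp [linearReward, inner_sub_right]

theorem mul_sum_norm_le_of_le_compatibility {r N : ℕ} {x : Fin N → X} {c : ℝ} (hc : 0 < c)
    (h : ENNReal.ofReal c ≤ compatibility φ r x) {J : Finset (Fin p)} (hJ : J.card ≤ r)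
    {b : Coeff d} (hcone : ∑ j ∈ Jᶜ, ‖b j‖ ≤ 3 * ∑ j ∈ J, ‖b j‖) :
    (c * ∑ j ∈ J, ‖b j‖) ^ 2 ≤ 1 / (N : ℝ) * ∑ i, linearReward φ b (x i) ^ 2 := by
  have hrhs : 0 ≤ ∑ i, linearReward φ b (x i) ^ 2 := Finset.sum_nonneg fun i _ => sq_nonneg _
  by_cases hb : b = 0
  · subst hb
    simpa using mul_nonneg (by positivity : (0 : ℝ) ≤ 1 / (N : ℝ)) hrhs
  have h1 := h.trans ((iInf₂_le J hJ).trans (iInf₂_le b hb) |>.trans (iInf_le _ hcone))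
  rw [ENNReal.ofReal_le_ofReal_iff (by positivity)] at h1
  have hS : 0 ≤ ∑ j ∈ J, ‖b j‖ := Finset.sum_nonneg fun j _ => norm_nonneg _
  have hS' : 0 < ∑ j ∈ J, ‖b j‖ := by
    refine lt_of_le_of_ne hS fun h0 => ?_
    rw [← h0, div_zero] at h1
    linarith
  rw [le_div_iff₀ hS'] at h1
  have h2 := pow_le_pow_left₀ (by positivity) h1 2
  rwa [mul_pow (1 / _), div_pow, Real.sq_sqrt hrhs, Real.sq_sqrt (Nat.cast_nonneg N),
    one_pow] at h2

/-- The `ℓ₁/ℓ₂` error bound of the group lasso under the compatibility condition. -/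
theorem sum_norm_sub_le_of_lassoLoss_le {N : ℕ} (hN : 0 < N) {x : Fin N → X} {e : Fin N → ℝ}
    {lam c : ℝ} (hlam : 0 < lam) (hc : 0 < c) {β b : Coeff d} {J : Finset (Fin p)}
    (hβ : ∀ j ∉ J, β j = 0) (hcomp : ENNReal.ofReal c ≤ compatibility φ J.card x)
    (hnoise : ∀ j, ‖∑ i, e i • φ j (x i)‖ ≤ lam / 4 * N)
    (hmin : lassoLoss φ lam (fun i => (x i, linearReward φ β (x i) + e i)) b ≤
      lassoLoss φ lam (fun i => (x i, linearReward φ β (x i) + e i)) β) :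
    ∑ j, ‖b j - β j‖ ≤ 6 * lam / c ^ 2 := by
  have hN' : (0 : ℝ) < N := by exact_mod_cast hN
  set Δ : Coeff d := b - β with hΔ
  set Q : ℝ := 1 / (N : ℝ) * ∑ i, linearReward φ Δ (x i) ^ 2 with hQ
  have hQ0 : 0 ≤ Q := mul_nonneg (by positivity) (Finset.sum_nonneg fun i _ => sq_nonneg _)
  set S : ℝ := ∑ j ∈ J, ‖Δ j‖ with hS
  set T : ℝ := ∑ j ∈ Jᶜ, ‖Δ j‖ with hT
  have hS0 : 0 ≤ S := Finset.sum_nonneg fun j _ => norm_nonneg _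
  have hT0 : 0 ≤ T := Finset.sum_nonneg fun j _ => norm_nonneg _
  have hST : ∑ j, ‖Δ j‖ = S + T := (Finset.sum_add_sum_compl J _).symm
  have hcross : ∑ i, e i * linearReward φ Δ (x i) ≤ lam / 4 * N * (S + T) := by
    calc ∑ i, e i * linearReward φ Δ (x i)
        = ∑ j, inner ℝ (∑ i, e i • φ j (x i)) (Δ j) := by
          simp only [linearReward, Finset.mul_sum, sum_inner, real_inner_smul_left]
          rw [Finset.sum_comm]
      _ ≤ ∑ j, lam / 4 * N * ‖Δ j‖ := Finset.sum_le_sum fun j _ =>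
          (real_inner_le_norm _ _).trans
            (mul_le_mul_of_nonneg_right (hnoise j) (norm_nonneg _))
      _ = lam / 4 * N * (S + T) := by rw [← Finset.mul_sum, hST]
  have hpen : ∑ j, ‖β j‖ - ∑ j, ‖b j‖ ≤ S - T := by
    rw [← Finset.sum_sub_distrib, ← Finset.sum_add_sum_compl J, sub_eq_add_neg, hS, hT,
      ← Finset.sum_neg_distrib]
    refine add_le_add (Finset.sum_le_sum fun j _ => ?_) (Finset.sum_le_sum fun j hj => ?_)
    · rw [hΔ, Pi.sub_apply, norm_sub_rev]
      exact norm_sub_norm_le _ _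
    · rw [hΔ, Pi.sub_apply, hβ j (Finset.mem_compl.1 hj)]
      simp
  -- Basic inequality: expanding the squares in `hmin` leaves the cross term, controlled by
  -- `hcross`, and the penalty difference, controlled by `hpen`.
  have hbasic : Q ≤ lam / 2 * (S + T) + lam * (S - T) := by
    have hexp : ∑ i, (linearReward φ β (x i) + e i - linearReward φ b (x i)) ^ 2 =
        ∑ i, e i ^ 2 - 2 * ∑ i, e i * linearReward φ Δ (x i) +
          ∑ i, linearReward φ Δ (x i) ^ 2 := by
      rw [Finset.mul_sum, ← Finset.sum_sub_distrib, ← Finset.sum_add_distrib]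
      refine Finset.sum_congr rfl fun i _ => ?_
      rw [hΔ, linearReward_sub]; ring
    simp only [lassoLoss, hexp, add_sub_cancel_left] at hmin
    have h1 : 1 / (N : ℝ) * ∑ i, e i * linearReward φ Δ (x i) ≤ lam / 4 * (S + T) := by
      rw [one_div, inv_mul_le_iff₀ hN']; linarith
    have h2 := mul_le_mul_of_nonneg_left hpen hlam.le
    rw [hQ]
    nlinarith
  -- Since `Q ≥ 0`, the basic inequality reads `0 ≤ lam (3 S - T) / 2`, which is the cone in the
  -- definition of `compatibility`. Compatibility then gives `c² S² ≤ Q ≤ 3 lam S / 2`, and `S + T ≤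
  -- 4 S` produces the constant 6.
  have hcone : T ≤ 3 * S := by nlinarith
  have hk := mul_sum_norm_le_of_le_compatibility hc hcomp le_rfl hcone
  have hfin : c ^ 2 * S ^ 2 ≤ 3 * lam / 2 * S := by
    rw [← mul_pow]
    have : 0 ≤ lam * T := by positivity
    nlinarith
  have hS1 : c ^ 2 * S ≤ 3 * lam / 2 := by
    rcases hS0.eq_or_lt with h0 | h0
    · rw [← h0]; simp; positivity
    · nlinarith
  have : ∑ j, ‖b j - β j‖ = S + T := hST
  rw [this, le_div_iff₀ (by positivity)]
  nlinarith [sq_nonneg c]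

/-- Every block error is below `min thr (c₁ - thr)`: too small to lift a zero block above `thr`, or
to push a block of norm at least `c₁` down to it. -/
theorem thresholdSupport_eq_of_lassoLoss_le {N : ℕ} (hN : 0 < N) {x : Fin N → X}
    {e : Fin N → ℝ} {c c₁ thr : ℝ} (hc : 0 < c) (hthr₀ : 0 < thr) (hthr₁ : thr < c₁)
    {β b : Coeff d} {J : Finset (Fin p)} (hβ : ∀ j ∉ J, β j = 0) (hβ₁ : ∀ j ∈ J, c₁ ≤ ‖β j‖)
    (hcomp : ENNReal.ofReal c ≤ compatibility φ J.card x)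
    (hnoise : ∀ j, ‖∑ i, e i • φ j (x i)‖ ≤ min thr (c₁ - thr) * c ^ 2 / 8 / 4 * N)
    (hmin : lassoLoss φ (min thr (c₁ - thr) * c ^ 2 / 8)
        (fun i => (x i, linearReward φ β (x i) + e i)) b ≤
      lassoLoss φ (min thr (c₁ - thr) * c ^ 2 / 8)
        (fun i => (x i, linearReward φ β (x i) + e i)) β) :
    thresholdSupport thr b = J := by
  set w := min thr (c₁ - thr) with hw
  have hw0 : 0 < w := lt_min hthr₀ (by linarith)
  have hsum := sum_norm_sub_le_of_lassoLoss_le hN (by positivity) hc hβ hcomp hnoise hmin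
  have hlt : ∀ j, ‖b j - β j‖ < w := fun j => by
    have h1 := Finset.single_le_sum (f := fun j => ‖b j - β j‖) (fun j _ => norm_nonneg _)
      (Finset.mem_univ j)
    have h2 : 6 * (w * c ^ 2 / 8) / c ^ 2 = 3 / 4 * w := by field_simp; norm_num
    linarith
  ext j
  simp only [thresholdSupport, Finset.mem_filter, Finset.mem_univ, true_and]
  have hj := hlt j
  constructor
  · intro h
    by_contra hjJ
    rw [hβ j hjJ, sub_zero] at hj
    linarith [min_le_left thr (c₁ - thr)]
  · intro h
    have h1 := hβ₁ j h
    have h2 := norm_sub_norm_le (β j) (b j)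
    rw [norm_sub_rev] at h2
    linarith [min_le_right thr (c₁ - thr)]

/-- A false index gets votes only from erring clients, fewer than `r α`; a true index loses at most
the erring votes, at most `r (1 - α)`. -/
theorem voteSupport_eq_of_few_errors {m r : ℕ} {α : ℝ} (hα₀ : 0 < α) (hα₁ : α < 1)
    {J : Fin m → Finset (Fin p)} {Jstar : Finset (Fin p)} (hr : 0 < r) (hrm : r ≤ m)
    (h : ∀ A : Finset (Fin m), (∀ s ∈ A, s.val < r) → (∀ s ∈ A, J s ≠ Jstar) →
      (A.card : ℝ) ≤ r * (min α (1 - α) / 2)) :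
    voteSupport α J r = Jstar := by
  classical
  have hr' : (0 : ℝ) < r := by exact_mod_cast hr
  have hmin : 0 < min α (1 - α) := lt_min hα₀ (by linarith)
  have hcard : (Finset.univ.filter fun s : Fin m => s.val < r).card = r := by
    rw [Fin.card_filter_val_lt, min_eq_right hrm]
  set A := (Finset.univ.filter fun s : Fin m => s.val < r ∧ J s ≠ Jstar) with hA
  have hAc : (A.card : ℝ) ≤ r * (min α (1 - α) / 2) :=
    h A (fun s hs => (Finset.mem_filter.1 hs).2.1) fun s hs => (Finset.mem_filter.1 hs).2.2
  ext j
  simp only [voteSupport, Finset.mem_filter, Finset.mem_univ, true_and]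
  constructor
  · intro hj
    by_contra hjJ
    have hsub : (Finset.univ.filter fun s : Fin m => s.val < r ∧ j ∈ J s).card ≤ A.card := by
      refine Finset.card_le_card fun s hs => ?_
      simp only [hA, Finset.mem_filter, Finset.mem_univ, true_and] at hs ⊢
      exact ⟨hs.1, fun h0 => hjJ (h0 ▸ hs.2)⟩
    have hsub' : ((Finset.univ.filter fun s : Fin m => s.val < r ∧ j ∈ J s).card : ℝ) ≤
        A.card := by exact_mod_cast hsub
    have := min_le_left α (1 - α)
    have h1 : (r : ℝ) * α ≤ r * (min α (1 - α) / 2) :=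
      (hj.trans (by convert! hsub')).trans hAc
    have h2 := le_of_mul_le_mul_left h1 hr'
    linarith
  · intro hj
    have hsub : r ≤ (Finset.univ.filter fun s : Fin m => s.val < r ∧ j ∈ J s).card + A.card := by
      conv_lhs => rw [← hcard]
      refine (Finset.card_le_card fun s hs => ?_).trans (Finset.card_union_le _ _)
      simp only [hA, Finset.mem_union, Finset.mem_filter, Finset.mem_univ, true_and] at hs ⊢
      by_cases h0 : J s = Jstar
      · exact .inl ⟨hs, h0 ▸ hj⟩
      · exact .inr ⟨hs, h0⟩
    have hsub' : (r : ℝ) ≤ (Finset.univ.filter fun s : Fin m => s.val < r ∧ j ∈ J s).card +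
        A.card := by exact_mod_cast hsub
    have := min_le_right α (1 - α)
    have h3 : (r : ℝ) * α ≤ (Finset.univ.filter fun s : Fin m => s.val < r ∧ j ∈ J s).card := by
      nlinarith
    convert! h3

/-- Coupling with the oracle through the same seeds, exploration points and noise. Tasks outside `T`
coincide with the oracle's action by action and pay only for exploration; tasks in `T` are charged
`2 * B` in every step. -/
theorem lifelongRegret_le_oracleRegret_add {S : Type*} {m n nexp : ℕ} {base : BaseAlgorithm X S}
    {kstar : X → X → ℝ} {K : Fin m → X → X → ℝ} {f : Fin m → X → ℝ} {B : ℝ}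
    (hf : ∀ s x, |f s x| ≤ B) (hB : 0 ≤ B) (T : Finset (Fin m)) (hK : ∀ s ∉ T, K s = kstar)
    (U : Fin m → S) (V : Fin m → Fin nexp → X) (E : Fin m → Fin n → ℝ) :
    lifelongRegret f (lifelongActions base f K U V E) ≤
      oracleRegret base kstar f U V E + 2 * B * m * nexp + 2 * B * n * T.card := by
  classical
  have hgap0 : ∀ s x, 0 ≤ (⨆ z, f s z) - f s x := fun s x => sub_nonneg.2 <|
    le_ciSup (f := f s) ⟨B, by rintro _ ⟨z, rfl⟩; exact (abs_le.1 (hf s z)).2⟩ x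
  have hgap1 : ∀ s x, (⨆ z, f s z) - f s x ≤ 2 * B := fun s x => by
    have : Nonempty X := ⟨x⟩
    have h1 : (⨆ z, f s z) ≤ B := ciSup_le fun z => (abs_le.1 (hf s z)).2
    linarith [(abs_le.1 (hf s x)).1]
  have htask : ∀ s, ∑ i, ((⨆ z, f s z) - f s (lifelongActions base f K U V E s i)) ≤
      ∑ i ∈ Finset.univ.filter (fun i : Fin n => nexp ≤ i.val),
        ((⨆ z, f s z) - f s (lifelongActions base f (fun _ => kstar) U V E s i)) +
      2 * B * nexp + if s ∈ T then 2 * B * n else 0 := by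
    intro s
    have horacle : 0 ≤ ∑ i ∈ Finset.univ.filter (fun i : Fin n => nexp ≤ i.val),
        ((⨆ z, f s z) - f s (lifelongActions base f (fun _ => kstar) U V E s i)) :=
      Finset.sum_nonneg fun i _ => hgap0 _ _
    split_ifs with hs
    · have h1 : ∑ i, ((⨆ z, f s z) - f s (lifelongActions base f K U V E s i)) ≤
          n * (2 * B) := by
        simpa using Finset.sum_le_card_nsmul Finset.univ
          (fun i => (⨆ z, f s z) - f s (lifelongActions base f K U V E s i)) (2 * B)
          fun i _ => hgap1 _ _
      have : 0 ≤ 2 * B * nexp := by positivity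
      linarith
    · have hact : ∀ i, lifelongActions base f K U V E s i =
          lifelongActions base f (fun _ => kstar) U V E s i := fun i => by
        simp only [lifelongActions, hK s hs]
      simp only [hact]
      rw [← Finset.sum_filter_add_sum_filter_not Finset.univ (fun i : Fin n => nexp ≤ i.val)]
      have h1 := Finset.sum_le_card_nsmul
        (Finset.univ.filter fun i : Fin n => ¬ nexp ≤ i.val)
        (fun i => (⨆ z, f s z) - f s (lifelongActions base f (fun _ => kstar) U V E s i))
        (2 * B) fun i _ => hgap1 _ _
      have h2 : (Finset.univ.filter fun i : Fin n => ¬ nexp ≤ i.val).card ≤ nexp := by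
        simp only [not_le, Fin.card_filter_val_lt]
        exact min_le_right _ _
      have h2' : ((Finset.univ.filter fun i : Fin n => ¬ nexp ≤ i.val).card : ℝ) ≤ nexp := by
        exact_mod_cast h2
      rw [nsmul_eq_mul] at h1
      nlinarith
  refine (Finset.sum_le_sum fun s _ => htask s).trans ?_
  rw [Finset.sum_add_distrib, Finset.sum_add_distrib, Finset.sum_ite_mem, Finset.univ_inter]
  simp only [Finset.sum_const, Finset.card_univ, Fintype.card_fin, nsmul_eq_mul]
  rw [oracleRegret]
  apply le_of_eq
  ring

end Deterministic

/-! ### Probability that many clients are noisy. -/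

section Clients

variable {Ω : Type*} [MeasurableSpace Ω] {μ : Measure Ω} {σ : ℝ}

theorem IsSubGaussian.congr {Y Y' : Ω → ℝ} (h : IsSubGaussian σ Y μ) (he : Y =ᵐ[μ] Y') :
    IsSubGaussian σ Y' μ where
  aemeasurable := h.aemeasurable.congr he
  mean_zero := by rw [← integral_congr_ae he, h.mean_zero]
  tail t ht := by
    refine le_trans (le_of_eq ?_) (h.tail t ht)
    refine measureReal_congr ?_
    filter_upwards [he] with ω hω
    apply propext
    change t ≤ |Y' ω| ↔ t ≤ |Y ω|
    rw [hω]

variable {X : Type} {p : ℕ} {d : Fin p → ℕ} {φ : FeatureMaps X d}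
  {m n N : ℕ}

variable [IsProbabilityMeasure μ]

theorem measure_exists_lt_norm_sum_feature_le {ι : Type*} (hφ : ∀ j x, ‖φ j x‖ ≤ 1)
    {Y : ι → Ω → ℝ} (hind : iIndepFun Y μ)
    (hm : ∀ i, Measurable (Y i)) (hY : ∀ i, IsSubGaussian σ (Y i) μ) (hσ : 0 < σ) {g : Fin N → ι}
    (hg : g.Injective) (hN : 0 < N) {τ a : ℝ} (hτ : 0 ≤ τ)
    (ha : Real.log p + 1 + a ≤ τ ^ 2 * N / (128 * σ ^ 2)) (x : Fin N → X) :
    μ {ω | ∃ j, τ * N < ‖∑ i, Y (g i) ω • φ j (x i)‖} ≤ ENNReal.ofReal (Real.exp (-a)) := by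
  have hind' : iIndepFun (fun i => Y (g i)) μ := hind.precomp hg
  have hone : ∀ j, μ {ω | τ * N < ‖∑ i, Y (g i) ω • φ j (x i)‖} ≤
      ENNReal.ofReal (Real.exp (1 - τ ^ 2 * N / (128 * σ ^ 2))) := fun j => by
    have := measure_lt_norm_sum_smul_le hind' (fun i => hm _) (fun i => hY _) hσ
      (fun i => φ j (x i)) (fun i => hφ _ _) Finset.univ (by simpa using hN) hτ
    simpa using this
  have hset : {ω | ∃ j, τ * N < ‖∑ i, Y (g i) ω • φ j (x i)‖} =
      ⋃ j, {ω | τ * N < ‖∑ i, Y (g i) ω • φ j (x i)‖} := by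
    ext ω; simp
  rw [hset]
  refine (measure_iUnion_fintype_le _ _).trans ((Finset.sum_le_sum fun j _ => hone j).trans ?_)
  rw [Finset.sum_const, nsmul_eq_mul, Finset.card_univ, Fintype.card_fin,
    ← ENNReal.ofReal_natCast, ← ENNReal.ofReal_mul (by positivity)]
  apply ENNReal.ofReal_le_ofReal
  -- The union over the kernels costs `p = exp (log p)`, except for `p = 0`, where `Real.log 0 = 0`
  -- but the union is empty.
  rcases Nat.eq_zero_or_pos p with rfl | hp
  · simpa using Real.exp_nonneg _
  · have hp' : (0 : ℝ) < p := by exact_mod_cast hp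
    calc (p : ℝ) * Real.exp (1 - τ ^ 2 * N / (128 * σ ^ 2))
        = Real.exp (Real.log p + (1 - τ ^ 2 * N / (128 * σ ^ 2))) := by
          rw [Real.exp_add, Real.exp_log hp']
      _ ≤ Real.exp (-a) := Real.exp_le_exp.2 (by linarith)

/-- The noise of client `s`, projected on the features of some base kernel at its exploration
points, is large. -/
def NoisyClient (φ : FeatureMaps X d) (h : N ≤ n) (τ : ℝ) (v : Fin m → Fin N → X)
    (e : Fin m → Fin n → ℝ) (s : Fin m) : Prop :=
  ∃ j, τ * N < ‖∑ i, e s (Fin.castLE h i) • φ j (v s i)‖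

/-- Among some first `r ≥ r₀` clients, more than `r γ` are noisy. -/
def ManyNoisyClients (φ : FeatureMaps X d) (h : N ≤ n) (τ γ : ℝ) (r₀ : ℕ)
    (v : Fin m → Fin N → X) (e : Fin m → Fin n → ℝ) : Prop :=
  ∃ r, r₀ ≤ r ∧ r ≤ m ∧ ∃ A : Finset (Fin m), (∀ s ∈ A, s.val < r) ∧ r * γ < A.card ∧
    ∀ s ∈ A, NoisyClient φ h τ v e s

variable [MeasurableSpace X]

theorem measurableSet_noisyClient (hφm : ∀ j, Measurable (φ j)) (h : N ≤ n) (τ : ℝ) (s : Fin m) :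
    MeasurableSet {q : (Fin m × Fin N → X) × (Fin m × Fin n → ℝ) |
      NoisyClient φ h τ (fun s i => q.1 (s, i)) (fun s i => q.2 (s, i)) s} := by
  have : {q : (Fin m × Fin N → X) × (Fin m × Fin n → ℝ) |
      NoisyClient φ h τ (fun s i => q.1 (s, i)) (fun s i => q.2 (s, i)) s} =
      ⋃ j, {q | τ * N < ‖∑ i, q.2 (s, Fin.castLE h i) • φ j (q.1 (s, i))‖} := by
    ext q; simp [NoisyClient]
  rw [this]
  refine MeasurableSet.iUnion fun j => measurableSet_lt measurable_const ?_
  have := hφm j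
  fun_prop

theorem measurableSet_manyNoisyClients (hφm : ∀ j, Measurable (φ j)) (h : N ≤ n) (τ γ : ℝ)
    (r₀ : ℕ) :
    MeasurableSet {q : (Fin m × Fin N → X) × (Fin m × Fin n → ℝ) |
      ManyNoisyClients φ h τ γ r₀ (fun s i => q.1 (s, i)) (fun s i => q.2 (s, i))} := by
  have : {q : (Fin m × Fin N → X) × (Fin m × Fin n → ℝ) |
      ManyNoisyClients φ h τ γ r₀ (fun s i => q.1 (s, i)) (fun s i => q.2 (s, i))} =
      ⋃ (r : ℕ) (_ : r₀ ≤ r ∧ r ≤ m) (A : Finset (Fin m))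
        (_ : (∀ s ∈ A, s.val < r) ∧ r * γ < A.card), ⋂ s ∈ A,
        {q | NoisyClient φ h τ (fun s i => q.1 (s, i)) (fun s i => q.2 (s, i)) s} := by
    ext q
    simp only [ManyNoisyClients, Set.mem_ofPred_eq, Set.mem_iUnion, Set.mem_iInter, exists_prop]
    constructor
    · rintro ⟨r, h1, h2, A, h3, h4, h5⟩
      exact ⟨r, ⟨h1, h2⟩, A, ⟨h3, h4⟩, h5⟩
    · rintro ⟨r, ⟨h1, h2⟩, A, ⟨h3, h4⟩, h5⟩
      exact ⟨r, h1, h2, A, h3, h4, h5⟩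
  rw [this]
  refine MeasurableSet.iUnion fun r => MeasurableSet.iUnion fun _ => MeasurableSet.iUnion fun A =>
    MeasurableSet.iUnion fun _ => MeasurableSet.biInter A.countable_toSet fun s _ =>
      measurableSet_noisyClient hφm h τ s

/-- Fubini reduces to frozen exploration points, as these are jointly independent of the noise.
Clients are then independent through the noise alone, so the points of different clients may depend
on each other. -/
theorem measure_manyNoisyClients_le (hφm : ∀ j, Measurable (φ j)) (hφ : ∀ j x, ‖φ j x‖ ≤ 1)
    (h : N ≤ n) (hN : 0 < N) (hσ : 0 < σ) {V : Fin m → Fin N → Ω → X} {E : Fin m → Fin n → Ω → ℝ}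
    (hV : ∀ s i, Measurable (V s i)) (hE : ∀ s i, IsSubGaussian σ (E s i) μ)
    (hind : iIndepFun (fun (q : Fin m × Fin n) => E q.1 q.2) μ)
    (hVE : IndepFun (fun ω (q : Fin m × Fin N) => V q.1 q.2 ω)
      (fun ω (q : Fin m × Fin n) => E q.1 q.2 ω) μ)
    {τ a γ : ℝ} (hτ : 0 ≤ τ) (ha₀ : 0 ≤ a) (haγ : 2 ≤ a * γ)
    (ha : Real.log p + 1 + a ≤ τ ^ 2 * N / (128 * σ ^ 2)) (r₀ : ℕ) :
    μ {ω | ManyNoisyClients φ h τ γ r₀ (fun s i => V s i ω) (fun s i => E s i ω)} ≤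
      ENNReal.ofReal (2 * Real.exp (-(a * γ / 2) * r₀)) := by
  -- The noise is only a.e. measurable; a measurable modification changes the event by a null set.
  let E' : Fin m × Fin n → Ω → ℝ := fun q => (hE q.1 q.2).aemeasurable.mk (E q.1 q.2)
  have hE'm : ∀ q, Measurable (E' q) := fun q => (hE q.1 q.2).aemeasurable.measurable_mk
  have hae : ∀ q : Fin m × Fin n, E q.1 q.2 =ᵐ[μ] E' q := fun q =>
    (hE q.1 q.2).aemeasurable.ae_eq_mk
  have hE' : ∀ q, IsSubGaussian σ (E' q) μ := fun q => (hE q.1 q.2).congr (hae q)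
  have hae' : (fun ω (q : Fin m × Fin n) => E q.1 q.2 ω) =ᵐ[μ] fun ω q => E' q ω := by
    filter_upwards [ae_all_iff.2 hae] with ω hω
    exact funext hω
  have hind' : iIndepFun E' μ := hind.congr hae
  have hVE' := hVE.congr (EventuallyEq.refl _ _) hae'
  set Bad : Set ((Fin m × Fin N → X) × (Fin m × Fin n → ℝ)) :=
    {q | ManyNoisyClients φ h τ γ r₀ (fun s i => q.1 (s, i)) (fun s i => q.2 (s, i))} with hBad
  have hBadm : MeasurableSet Bad := measurableSet_manyNoisyClients hφm h τ γ r₀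
  have hVm : Measurable fun ω (q : Fin m × Fin N) => V q.1 q.2 ω :=
    measurable_pi_lambda _ fun q => hV _ _
  have hEm : Measurable fun ω (q : Fin m × Fin n) => E' q ω := measurable_pi_lambda _ hE'm
  have hfix : ∀ v : Fin m × Fin N → X, μ {ω | (v, fun q => E' q ω) ∈ Bad} ≤
      ENNReal.ofReal (2 * Real.exp (-(a * γ / 2) * r₀)) := by
    intro v
    refine measure_exists_many_blocks_le hind' hE'm (κ := Fin n)
      (B := fun s => {e | ∃ j, τ * N < ‖∑ i, e (Fin.castLE h i) • φ j (v (s, i))‖}) ?_ ha₀ haγ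
      ?_ r₀
    · intro s
      have : {e : Fin n → ℝ | ∃ j, τ * N < ‖∑ i, e (Fin.castLE h i) • φ j (v (s, i))‖} =
          ⋃ j, {e | τ * N < ‖∑ i, e (Fin.castLE h i) • φ j (v (s, i))‖} := by
        ext e; simp
      rw [this]
      exact MeasurableSet.iUnion fun j => measurableSet_lt measurable_const (by fun_prop)
    · intro s
      refine measure_exists_lt_norm_sum_feature_le hφ hind' hE'm hE' hσ
        (g := fun i => (s, Fin.castLE h i)) ?_ hN hτ ha fun i => v (s, i)
      intro i i' hii
      simpa using hii
  calc μ {ω | ManyNoisyClients φ h τ γ r₀ (fun s i => V s i ω) (fun s i => E s i ω)}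
      = μ {ω | (fun q : Fin m × Fin N => V q.1 q.2 ω, fun q => E' q ω) ∈ Bad} := by
        refine measure_congr ?_
        filter_upwards [hae'] with ω hω
        apply propext
        change ManyNoisyClients φ h τ γ r₀ _ (fun s i => (fun q : Fin m × Fin n => E q.1 q.2 ω)
          (s, i)) ↔ ManyNoisyClients φ h τ γ r₀ _ fun s i => E' (s, i) ω
        rw [hω]
    _ = ∫⁻ ω, Bad.indicator 1 (fun q : Fin m × Fin N => V q.1 q.2 ω, fun q => E' q ω) ∂μ := by
        exact (lintegral_indicator_one (hBadm.preimage (hVm.prodMk hEm))).symm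
    _ = ∫⁻ ω, ∫⁻ ω', Bad.indicator 1
          (fun q : Fin m × Fin N => V q.1 q.2 ω, fun q => E' q ω') ∂μ ∂μ :=
        lintegral_comp_prodMk_of_indepFun hVm hEm hVE' (measurable_one.indicator hBadm)
    _ ≤ ∫⁻ _, ENNReal.ofReal (2 * Real.exp (-(a * γ / 2) * r₀)) ∂μ := by
        refine lintegral_mono fun ω => ?_
        refine le_trans (le_of_eq ?_) (hfix fun q => V q.1 q.2 ω)
        exact lintegral_indicator_one (hBadm.preimage (measurable_const.prodMk hEm))
    _ = _ := by simp

end Clients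

/-! ### From correct votes to a high-probability regret bound. -/

section Regret

variable {X : Type} {p : ℕ} {d : Fin p → ℕ} {φ : FeatureMaps X d} {m n N : ℕ}

theorem serverKernel_eq_of_not_manyNoisyClients {α cκ c₁ thr : ℝ} (hα₀ : 0 < α) (hα₁ : α < 1)
    (hcκ : 0 < cκ) (hthr₀ : 0 < thr) (hthr₁ : thr < c₁) (h : N ≤ n) (hN : 0 < N)
    {Jstar : Finset (Fin p)} {f : Fin m → X → ℝ} {β : Fin m → Coeff d}
    (hf : ∀ s x, f s x = linearReward φ (β s) x) (hβ : ∀ s, ∀ j ∉ Jstar, β s j = 0)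
    (hβ₁ : ∀ s, ∀ j ∈ Jstar, c₁ ≤ ‖β s j‖) {solve : (Fin N → X × ℝ) → Coeff d}
    (hsolve : ∀ D b, lassoLoss φ (min thr (c₁ - thr) * cκ ^ 2 / 8) D (solve D) ≤
      lassoLoss φ (min thr (c₁ - thr) * cκ ^ 2 / 8) D b)
    {V : Fin m → Fin N → X} {E : Fin m → Fin n → ℝ}
    (hcomp : ∀ s, ENNReal.ofReal cκ ≤ compatibility φ Jstar.card (V s)) {r₀ : ℕ} (hr₀ : 0 < r₀)
    (hgood : ¬ ManyNoisyClients φ h (min thr (c₁ - thr) * cκ ^ 2 / 8 / 4)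
      (min α (1 - α) / 2) r₀ V E) {r : ℕ} (hr : r₀ ≤ r) (hrm : r ≤ m) :
    serverKernel φ solve thr α h f V E r = avgKernel φ Jstar := by
  unfold serverKernel
  congr 1
  refine voteSupport_eq_of_few_errors hα₀ hα₁ (hr₀.trans_le hr) hrm fun A hA hne => ?_
  by_contra hcard
  refine hgood ⟨r, hr, hrm, A, hA, not_le.1 hcard, fun s hs => ?_⟩
  by_contra hquiet
  simp only [NoisyClient, not_exists, not_lt] at hquiet
  refine hne s hs (thresholdSupport_eq_of_lassoLoss_le hN hcκ hthr₀ hthr₁ (hβ s) (hβ₁ s)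
    (hcomp s) hquiet ?_)
  have hD : explorationData h f V E s = fun i =>
      (V s i, linearReward φ (β s) (V s i) + E s (Fin.castLE h i)) := by
    funext i; simp [explorationData, hf]
  rw [hD]
  exact hsolve _ _

variable {Ω S : Type*} [MeasurableSpace Ω] {μ : Measure Ω}

theorem ProbGreater.of_probAtLeast {q q' : ℝ} {P P' : Ω → Prop} (h : ProbAtLeast μ q P)
    (hq : q' < q) (hP : ∀ ω, P ω → P' ω) : ProbGreater μ q' P' :=
  let ⟨A, hA, hqA, hPA⟩ := h
  ⟨A, hA, hq.trans_le hqA, fun ω hω => hP ω (hPA ω hω)⟩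

theorem ProbGreater.of_forall_and_and_not [IsProbabilityMeasure μ] {q₁ q₂ : ℝ} {ε : ℝ} (hε : 0 ≤ ε)
    {P₁ P₂ P₃ Q : Ω → Prop} (h₁ : ProbAtLeast μ (1 - q₁) P₁) (h₂ : ProbAtLeast μ (1 - q₂) P₂)
    (h₃ : μ {ω | P₃ ω} ≤ ENNReal.ofReal ε) {q : ℝ} (hq : q₁ + q₂ + ε < q)
    (hQ : ∀ ω, P₁ ω → P₂ ω → ¬ P₃ ω → Q ω) : ProbGreater μ (1 - q) Q := by
  obtain ⟨A₁, hA₁, hq₁, hP₁⟩ := h₁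
  obtain ⟨A₂, hA₂, hq₂, hP₂⟩ := h₂
  set A₃ := toMeasurable μ {ω | P₃ ω} with hA₃
  have hA₃m : MeasurableSet A₃ := measurableSet_toMeasurable _ _
  have hq₃ : μ.real A₃ ≤ ε := by
    refine ENNReal.toReal_le_of_le_ofReal hε ?_
    rwa [hA₃, measure_toMeasurable]
  refine ⟨A₁ ∩ A₂ ∩ A₃ᶜ, (hA₁.inter hA₂).inter hA₃m.compl, ?_, fun ω hω =>
    hQ ω (hP₁ ω hω.1.1) (hP₂ ω hω.1.2) fun h => hω.2 (subset_toMeasurable μ _ h)⟩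
  have e₁ : μ.real A₁ᶜ = 1 - μ.real A₁ := probReal_compl_eq_one_sub hA₁
  have e₂ : μ.real A₂ᶜ = 1 - μ.real A₂ := probReal_compl_eq_one_sub hA₂
  have e : μ.real (A₁ ∩ A₂ ∩ A₃ᶜ)ᶜ = 1 - μ.real (A₁ ∩ A₂ ∩ A₃ᶜ) :=
    probReal_compl_eq_one_sub ((hA₁.inter hA₂).inter hA₃m.compl)
  have hle : μ.real (A₁ ∩ A₂ ∩ A₃ᶜ)ᶜ ≤ μ.real A₁ᶜ + μ.real A₂ᶜ + μ.real A₃ := by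
    rw [Set.compl_inter, Set.compl_inter, compl_compl]
    exact (measureReal_union_le _ _).trans (add_le_add_left (measureReal_union_le _ _) _)
  linarith

/-- Covers `m * p = 0`, where the logarithm in `excessRate` is `Real.log 0 = 0` and cannot pay for
small `δ`. Zero rewards incur no regret, whatever the kernels. -/
theorem probGreater_fliboRegret_le_of_eq_zero {α thr : ℝ} (h : N ≤ n)
    {k : X → X → ℝ} {B δ Rstar : ℝ} (hδ : 0 < δ)
    {f : Fin m → X → ℝ} (hf : ∀ s x, f s x = 0) (hfB : ∀ s, InRKHSBall k B (f s))
    {U : Fin m → Ω → S} {V : Fin m → Fin N → Ω → X} {E : Fin m → Fin n → Ω → ℝ}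
    {base : BaseAlgorithm X S} (horacle : HasOracleRegret base k B (1 - δ / 2) Rstar U V E μ)
    (solve : (Fin N → X × ℝ) → Coeff d) (votes : Fin m → ℕ) :
    ProbGreater μ (1 - δ) fun ω =>
      fliboRegret base φ solve thr α h votes f (fun s => U s ω) (fun s i => V s i ω)
        (fun s i => E s i ω) ≤ Rstar := by
  refine ProbGreater.of_probAtLeast (horacle f hfB) (by linarith) fun ω hω => ?_
  have hreg := lifelongRegret_le_oracleRegret_add (base := base) (kstar := k)
    (K := fun s => serverKernel φ solve thr α h f (fun s i => V s i ω) (fun s i => E s i ω)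
      (votes s)) (f := f) (B := 0) (fun s x => by simp [hf]) le_rfl Finset.univ (by simp)
    (fun s => U s ω) (fun s i => V s i ω) (fun s i => E s i ω)
  refine hreg.trans ?_
  simpa using hω

variable [IsProbabilityMeasure μ] [MeasurableSpace X]

/-- High-probability regret bound for an arbitrary voting schedule. -/
theorem probGreater_fliboRegret_le {σ α cκ c₁ thr : ℝ} (hσ : 0 < σ) (hα₀ : 0 < α) (hα₁ : α < 1)
    (hcκ : 0 < cκ) (hthr₀ : 0 < thr) (hthr₁ : thr < c₁) (h : N ≤ n) (hN : 0 < N)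
    (hφm : ∀ j, Measurable (φ j)) (hk : ∀ j x x', baseKernel φ j x x' ≤ 1)
    {Jstar : Finset (Fin p)} {B δ Rstar : ℝ} (hB : 0 < B)
    {f : Fin m → X → ℝ} {β : Fin m → Coeff d}
    (hf : ∀ s x, f s x = linearReward φ (β s) x) (hβ : ∀ s, ∀ j ∉ Jstar, β s j = 0)
    (hfB : ∀ s, InRKHSBall (avgKernel φ Jstar) B (f s))
    (hβ₁ : ∀ s, ∀ j ∈ Jstar, c₁ ≤ ‖β s j‖)
    {U : Fin m → Ω → S} {V : Fin m → Fin N → Ω → X} {E : Fin m → Fin n → Ω → ℝ}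
    (hV : ∀ s i, Measurable (V s i)) (hE : ∀ s i, IsSubGaussian σ (E s i) μ)
    (hind : iIndepFun (fun (q : Fin m × Fin n) => E q.1 q.2) μ)
    (hVE : IndepFun (fun ω (q : Fin m × Fin N) => V q.1 q.2 ω)
      (fun ω (q : Fin m × Fin n) => E q.1 q.2 ω) μ)
    (hcomp : ProbAtLeast μ (1 - δ / 4) fun ω =>
      ∀ s, ENNReal.ofReal cκ ≤ compatibility φ Jstar.card (fun i => V s i ω))
    {base : BaseAlgorithm X S}
    (horacle : HasOracleRegret base (avgKernel φ Jstar) B (1 - δ / 2) Rstar U V E μ)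
    {solve : (Fin N → X × ℝ) → Coeff d}
    (hsolve : ∀ D b, lassoLoss φ (min thr (c₁ - thr) * cκ ^ 2 / 8) D (solve D) ≤
      lassoLoss φ (min thr (c₁ - thr) * cκ ^ 2 / 8) D b)
    {a : ℝ} (ha₀ : 0 ≤ a) (haγ : 2 ≤ a * (min α (1 - α) / 2))
    (ha : Real.log p + 1 + a ≤
      (min thr (c₁ - thr) * cκ ^ 2 / 8 / 4) ^ 2 * N / (128 * σ ^ 2))
    {r₀ : ℕ} (hr₀ : 0 < r₀)
    (hδ : 2 * Real.exp (-(a * (min α (1 - α) / 2) / 2) * r₀) < δ / 4)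
    (votes : Fin m → ℕ) (hvotes : ∀ s, votes s ≤ m) :
    ProbGreater μ (1 - δ) fun ω =>
      fliboRegret base φ solve thr α h votes f (fun s => U s ω) (fun s i => V s i ω)
        (fun s i => E s i ω) ≤ Rstar + 2 * B * m * N +
          2 * B * n * (Finset.univ.filter fun s => votes s < r₀).card := by
  have hw : 0 < min thr (c₁ - thr) := lt_min hthr₀ (by linarith)
  have hnoise := measure_manyNoisyClients_le hφm (norm_feature_le_one hk) h hN hσ hV hE hind hVE
    (τ := min thr (c₁ - thr) * cκ ^ 2 / 8 / 4) (by positivity) ha₀ haγ ha r₀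
  -- Failure budget: `δ / 4` for compatibility, `δ / 2` for the oracle and, strictly, less than `δ /
  -- 4` for the noise, which gives the strict inequality.
  refine ProbGreater.of_forall_and_and_not (by positivity) hcomp (horacle f hfB) hnoise
    (by linarith) fun ω hω₁ hω₂ hω₃ => ?_
  have hreg := lifelongRegret_le_oracleRegret_add (base := base) (kstar := avgKernel φ Jstar)
    (K := fun s => serverKernel φ solve thr α h f (fun s i => V s i ω) (fun s i => E s i ω)
      (votes s)) (f := f) (B := B)
    (fun s x => (hfB s).abs_le (avgKernel_self_nonneg _ _) (avgKernel_self_le_one hk _ _)) hB.le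
    (Finset.univ.filter fun s => votes s < r₀) (fun s hs => by
      have hs' : r₀ ≤ votes s := by simpa using hs
      exact serverKernel_eq_of_not_manyNoisyClients hα₀ hα₁ hcκ hthr₀ hthr₁ h hN hf hβ hβ₁ hsolve
        hω₁ hr₀ hω₃ hs' (hvotes s))
    (fun s => U s ω) (fun s i => V s i ω) (fun s i => E s i ω)
  exact hreg.trans (by linarith)

end Regret

/-! ### The excess rate and its asymptotics. -/

section Rate

theorem log_mul_div_nonneg {δ : ℝ} (hδ₀ : 0 < δ) (hδ₁ : δ < 1) (m p : ℕ) :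
    0 ≤ Real.log ((m : ℝ) * p / δ) := by
  rcases Nat.eq_zero_or_pos (m * p) with h | h
  · have : (m : ℝ) * p = 0 := by exact_mod_cast h
    simp [this]
  · have : (1 : ℝ) ≤ m * p := by exact_mod_cast h
    exact Real.log_nonneg ((one_le_div hδ₀).2 (by linarith))

theorem excessRate_nonneg {B δ : ℝ} (hB : 0 ≤ B) (hδ₀ : 0 < δ) (hδ₁ : δ < 1) (m n p : ℕ) :
    0 ≤ excessRate B δ m n p := by
  have hlog := log_mul_div_nonneg hδ₀ hδ₁ m p
  unfold excessRate
  positivity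

theorem mul_sqrt_le_excessRate {B δ : ℝ} (hB : 0 ≤ B) (hδ₀ : 0 < δ) (hδ₁ : δ < 1) (m n p : ℕ) :
    B * m * √(n : ℝ) ≤ excessRate B δ m n p := by
  have hlog := log_mul_div_nonneg hδ₀ hδ₁ m p
  have : 0 ≤ B * √(n : ℝ) * Real.log ((m : ℝ) * p / δ) := by positivity
  unfold excessRate
  linarith

theorem excessRate_isLittleO (B δ : ℝ) (m p : ℕ) :
    (fun n : ℕ => excessRate B δ m n p) =o[atTop] (fun n : ℕ => (n : ℝ)) := by
  have hsqrt : (fun n : ℕ => √(n : ℝ)) =o[atTop] (fun n : ℕ => (n : ℝ)) := by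
    have h := (isLittleO_pow_pow_atTop_of_lt (𝕜 := ℝ) one_lt_two).comp_tendsto
      (Real.tendsto_sqrt_atTop.comp (tendsto_natCast_atTop_atTop (R := ℝ)))
    simpa [Function.comp_def] using h
  have := hsqrt.const_mul_left (B * m + B * Real.log ((m : ℝ) * p / δ))
  refine this.congr_left fun n => ?_
  unfold excessRate
  ring

/-- The exploration term contributes `C * B * √n` per task, independently of `m`. -/
theorem not_tendsto_excessRate_div {B δ C : ℝ} (hC : 0 < C) (hB : 0 < B) (hδ₀ : 0 < δ)
    (hδ₁ : δ < 1) {n : ℕ} (hn : 0 < n) (p : ℕ) :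
    ¬ Tendsto (fun m : ℕ => C * excessRate B δ m n p / m) atTop (𝓝 0) := by
  intro h
  have hn' : (0 : ℝ) < n := by exact_mod_cast hn
  have hle : C * (B * √(n : ℝ)) ≤ 0 := by
    refine ge_of_tendsto h ?_
    filter_upwards [eventually_gt_atTop 0] with m hm
    have hm' : (0 : ℝ) < m := by exact_mod_cast hm
    rw [le_div_iff₀ hm']
    have := mul_le_mul_of_nonneg_left (mul_sqrt_le_excessRate hB.le hδ₀ hδ₁ m n p) hC.le
    linarith
  have : 0 < C * (B * √(n : ℝ)) := by positivity
  linarith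

theorem card_filter_val_add_lt_le {m r₀ : ℕ} (c : ℕ) :
    (Finset.univ.filter fun s : Fin m => s.val + c < r₀).card ≤ r₀ - c := by
  have : (Finset.univ.filter fun s : Fin m => s.val + c < r₀) =
      Finset.univ.filter fun s : Fin m => s.val < r₀ - c := by
    ext s; simp; omega
  rw [this, Fin.card_filter_val_lt]
  exact min_le_right _ _

/-- The cost of exploration and of `log (8 / δ) / (A N)` tasks with a wrong kernel. -/
theorem cost_le_excessRate {B δ A : ℝ} (hB : 0 < B) (hδ₀ : 0 < δ) (hδ₁ : δ < 1) (hA : 0 < A)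
    {m n p : ℕ} (hm : 0 < m) (hp : 0 < p) (hn : 0 < n) {t : ℝ}
    (ht : t ≤ Real.log (8 / δ) / (A * Nat.sqrt n)) :
    2 * B * m * Nat.sqrt n + 2 * B * n * t ≤ (2 + 12 / A) * excessRate B δ m n p := by
  have hm' : (1 : ℝ) ≤ m := by exact_mod_cast hm
  have hmp : (1 : ℝ) ≤ m * p := by exact_mod_cast Nat.mul_pos hm hp
  have hN : (1 : ℝ) ≤ Nat.sqrt n := by exact_mod_cast Nat.sqrt_pos.2 hn
  set r : ℝ := √(n : ℝ) with hr
  have hr0 : 0 ≤ r := Real.sqrt_nonneg _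
  have hrr : r * r = n := Real.mul_self_sqrt (Nat.cast_nonneg n)
  have hNr : (Nat.sqrt n : ℝ) ≤ r := Real.nat_sqrt_le_real_sqrt
  have hrN : r ≤ 2 * Nat.sqrt n := by
    have : r ≤ Nat.sqrt n + 1 := Real.real_sqrt_le_nat_sqrt_succ
    linarith
  set l : ℝ := Real.log (m * p / δ) with hl
  have hL : Real.log (8 / δ) ≤ 3 + l := by
    have h8 : Real.log 8 ≤ 3 := by
      have : Real.log 8 = 3 * Real.log 2 := by
        rw [show (8 : ℝ) = 2 ^ 3 by norm_num, Real.log_pow]; norm_num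
      linarith [Real.log_le_sub_one_of_pos (zero_lt_two (α := ℝ))]
    have h0 : 0 ≤ Real.log (m * p : ℝ) := Real.log_nonneg hmp
    rw [hl, Real.log_div (by norm_num) hδ₀.ne', Real.log_div (by positivity) hδ₀.ne']
    linarith
  have hl0 : 0 ≤ l := Real.log_nonneg ((one_le_div hδ₀).2 (by linarith))
  have hL0 : 0 ≤ Real.log (8 / δ) := Real.log_nonneg ((one_le_div hδ₀).2 (by linarith))
  -- Writing `n = r * r ≤ r * (2 * Nat.sqrt n)` cancels the `Nat.sqrt n` in the denominator of `t`
  -- and leaves one factor `√n`.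
  have hn_t : n * t ≤ 2 * r * (3 + l) / A := by
    calc (n : ℝ) * t ≤ n * (Real.log (8 / δ) / (A * Nat.sqrt n)) := by gcongr
      _ ≤ (r * (2 * Nat.sqrt n)) * ((3 + l) / (A * Nat.sqrt n)) := by
          rw [← hrr]; gcongr
      _ = 2 * r * (3 + l) / A := by field_simp
  have h1 : 2 * B * m * Nat.sqrt n ≤ 2 * (B * m * r) := by
    calc 2 * B * m * Nat.sqrt n ≤ 2 * B * m * r := by gcongr
      _ = _ := by ring
  have h2 : 2 * B * n * t ≤ 12 / A * (B * m * r + B * r * l) := by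
    calc 2 * B * n * t = 2 * B * (n * t) := by ring
      _ ≤ 2 * B * (2 * r * (3 + l) / A) := by gcongr
      _ = 12 / A * (B * 1 * r + B * r * (l / 3)) := by ring
      -- The constant part of `3 + l` is absorbed into the exploration term because `m ≥ 1`.
      _ ≤ 12 / A * (B * m * r + B * r * l) := by
          gcongr
          linarith
  have h3 : 0 ≤ B * r * l := by positivity
  unfold excessRate
  linarith

end Rate
end FLiBO

/-! ### Choice of the constants and the final bounds. -/

theorem mainTheorem3
    (σ α cκ c₁ thr : ℝ) (hσ : 0 < σ) (hα₀ : 0 < α) (hα₁ : α < 1) (hcκ : 0 < cκ)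
    (hthr₀ : 0 < thr) (hthr₁ : thr < c₁) :
    ∃ C N₀ : ℝ, 0 < C ∧ 0 < N₀ ∧
      (∀ (d₀ : ℕ) (𝒳 : Set (EuclideanSpace ℝ (Fin d₀))) (_ : IsCompact 𝒳)
        (p : ℕ) (d : Fin p → ℕ) (φ : FLiBO.FeatureMaps 𝒳 d)
        (_ : ∀ j, Measurable (φ j)) (_ : ∀ j x x', FLiBO.baseKernel φ j x x' ≤ 1)
        (Jstar : Finset (Fin p)) (m n : ℕ) (B δ Rstar : ℝ)
        (_ : 0 < B) (_ : 0 < δ) (_ : δ < 1)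
        (_ : N₀ * (1 + Real.log p) ≤ √(n : ℝ))
        -- rewards
        (f : Fin m → 𝒳 → ℝ) (β : Fin m → FLiBO.Coeff d)
        (_ : ∀ s x, f s x = FLiBO.linearReward φ (β s) x)
        (_ : ∀ s, ∀ j ∉ Jstar, β s j = 0)
        (_ : ∀ s, FLiBO.InRKHSBall (FLiBO.avgKernel φ Jstar) B (f s))
        (_ : ∀ s, ∀ j ∈ Jstar, c₁ ≤ ‖β s j‖)
        -- probability space, seeds of the base algorithm, exploration points, noise
        (Ω S : Type*) (_ : MeasurableSpace Ω) (μ : Measure Ω) (_ : IsProbabilityMeasure μ)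
        (U : Fin m → Ω → S) (V : Fin m → Fin (Nat.sqrt n) → Ω → 𝒳) (E : Fin m → Fin n → Ω → ℝ)
        (_ : ∀ s i, Measurable (V s i))
        (_ : ∀ s i, FLiBO.IsSubGaussian σ (E s i) μ)
        (_ : iIndepFun (fun (q : Fin m × Fin n) => E q.1 q.2) μ)
        (_ : IndepFun (fun ω (q : Fin m × Fin (Nat.sqrt n)) => V q.1 q.2 ω)
          (fun ω (q : Fin m × Fin n) => E q.1 q.2 ω) μ)
        -- the exploration data are sufficiently informative
        (_ : FLiBO.ProbAtLeast μ (1 - δ / 4) fun ω =>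
          ∀ s, ENNReal.ofReal cκ ≤ FLiBO.compatibility φ Jstar.card (fun i => V s i ω))
        -- the base algorithm and the local group lasso solver
        (base : FLiBO.BaseAlgorithm 𝒳 S)
        (_ : FLiBO.HasOracleRegret base (FLiBO.avgKernel φ Jstar) B (1 - δ / 2) Rstar U V E μ)
        (solve : (Fin (Nat.sqrt n) → 𝒳 × ℝ) → FLiBO.Coeff d)
        (_ : ∀ D b, FLiBO.lassoLoss φ (min thr (c₁ - thr) * cκ ^ 2 / 8) D (solve D) ≤
          FLiBO.lassoLoss φ (min thr (c₁ - thr) * cκ ^ 2 / 8) D b),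
        -- client `s` uses the vote of all clients up to and including itself
        FLiBO.ProbGreater μ (1 - δ) (fun ω =>
          FLiBO.fliboRegret base φ solve thr α (Nat.sqrt_le_self n) (fun s => s.val + 1) f
              (fun s => U s ω) (fun s i => V s i ω) (fun s i => E s i ω) - Rstar ≤
            C * FLiBO.excessRate B δ m n p) ∧
        -- client `s` uses the vote of the earlier clients only
        FLiBO.ProbGreater μ (1 - δ) (fun ω =>
          FLiBO.fliboRegret base φ solve thr α (Nat.sqrt_le_self n) (fun s => s.val) f
              (fun s => U s ω) (fun s i => V s i ω) (fun s i => E s i ω) - Rstar ≤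
            C * FLiBO.excessRate B δ m n p + 2 * B * n)) ∧
      -- the first bound is sublinear in `n` whenever the oracle regret is
      (∀ (p m : ℕ) (B δ : ℝ) (Rstar : ℕ → ℝ), 0 < B → 0 < δ → δ < 1 →
        Rstar =o[atTop] (fun n : ℕ => (n : ℝ)) →
        (fun n : ℕ => Rstar n + C * FLiBO.excessRate B δ m n p) =o[atTop]
          (fun n : ℕ => (n : ℝ))) ∧
      -- its excess per task does not vanish as the number of tasks grows
      (∀ (p n : ℕ) (B δ : ℝ), 0 < B → 0 < δ → δ < 1 → 0 < n →
        ¬ Tendsto (fun m : ℕ => C * FLiBO.excessRate B δ m n p / m) atTop (𝓝 0)) := by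
  have hw : 0 < min thr (c₁ - thr) := lt_min hthr₀ (by linarith)
  set τ : ℝ := min thr (c₁ - thr) * cκ ^ 2 / 8 / 4 with hτ
  set γ : ℝ := min α (1 - α) / 2 with hγ
  have hγ₀ : 0 < γ := half_pos (lt_min hα₀ (by linarith))
  have hτ₀ : 0 < τ := by positivity
  set A₀ : ℝ := τ ^ 2 / (128 * σ ^ 2) with hA₀
  have hA₀' : 0 < A₀ := by positivity
  set A : ℝ := A₀ * γ / 4 with hA
  have hA' : 0 < A := by positivity
  -- With `N = Nat.sqrt n`, the noise exponent of a client is `A₀ N`. In `N₀`, the summand `4 / A₀`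
  -- makes half of it dominate `1 + log p`, and `8 / (A₀ γ)` makes the other half `a` satisfy `a γ ≥
  -- 2`. The decay rate per voter is then `a γ / 2 = A N`.
  refine ⟨2 + 12 / A, 4 / A₀ + 8 / (A₀ * γ), by positivity, by positivity, ?_, ?_, ?_⟩
  · intro d₀ 𝒳 _ p d φ hφm hk Jstar m n B δ Rstar hB hδ₀ hδ₁ hN₀ f β hf hβ hfB hβ₁ Ω S _ μ _ U V E
      hV hE hind hVE hcomp base horacle solve hsolve
    have hlogp : 0 ≤ Real.log p := Real.log_natCast_nonneg p
    have hrate := FLiBO.excessRate_nonneg hB.le hδ₀ hδ₁ m n p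
    rcases Nat.eq_zero_or_pos (m * p) with hmp | hmp
    · have hf0 : ∀ s x, f s x = 0 := by
        rcases Nat.mul_eq_zero.1 hmp with rfl | rfl
        · exact fun s => s.elim0
        · intro s x
          rw [hf]
          simp [FLiBO.linearReward]
      have h := fun votes => FLiBO.probGreater_fliboRegret_le_of_eq_zero (φ := φ) (α := α)
        (thr := thr) (Nat.sqrt_le_self n) hδ₀ hf0 hfB horacle solve votes
      obtain ⟨G, hG, hqG, hPG⟩ := h fun s => s.val + 1
      obtain ⟨G', hG', hqG', hPG'⟩ := h fun s => s.val
      have hC : 0 ≤ (2 + 12 / A) * FLiBO.excessRate B δ m n p := by positivity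
      have hBn : 0 ≤ 2 * B * n := by positivity
      exact ⟨⟨G, hG, hqG, fun ω hω => by linarith [hPG ω hω]⟩,
        ⟨G', hG', hqG', fun ω hω => by linarith [hPG' ω hω]⟩⟩
    · have hm : 0 < m := Nat.pos_of_mul_pos_right hmp
      have hp : 0 < p := Nat.pos_of_mul_pos_left hmp
      have hn : 0 < n := by
        rcases Nat.eq_zero_or_pos n with rfl | h
        · have : 0 < (4 / A₀ + 8 / (A₀ * γ)) * (1 + Real.log p) := by positivity
          simp only [Nat.cast_zero, Real.sqrt_zero] at hN₀
          linarith
        · exact h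
      have hN : 0 < Nat.sqrt n := Nat.sqrt_pos.2 hn
      have hN1 : (1 : ℝ) ≤ Nat.sqrt n := by exact_mod_cast hN
      have hN2 : (4 / A₀ + 8 / (A₀ * γ)) * (1 + Real.log p) ≤ 2 * Nat.sqrt n := by
        have : √(n : ℝ) ≤ Nat.sqrt n + 1 := Real.real_sqrt_le_nat_sqrt_succ
        linarith
      have hNa : 2 * (1 + Real.log p) ≤ A₀ * Nat.sqrt n := by
        have h1 : 4 / A₀ * (1 + Real.log p) ≤ 2 * Nat.sqrt n := by
          refine le_trans ?_ hN2
          gcongr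
          have : 0 < 8 / (A₀ * γ) := by positivity
          linarith
        rw [div_mul_eq_mul_div, div_le_iff₀ hA₀'] at h1
        linarith
      have hNγ : 4 ≤ A₀ * Nat.sqrt n * γ := by
        have h1 : 8 / (A₀ * γ) * 1 ≤ 2 * Nat.sqrt n := by
          refine le_trans ?_ hN2
          gcongr
          · have : 0 < 4 / A₀ := by positivity
            linarith
          · linarith
        rw [mul_one, div_le_iff₀ (by positivity)] at h1
        linarith
      set a : ℝ := A₀ * Nat.sqrt n / 2 with ha
      -- Solves `2 * exp (-(A N) t) = δ / 4`; the next larger integer `⌊t⌋₊ + 1` serves as `r₀` and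
      -- makes the inequality strict.
      set t : ℝ := Real.log (8 / δ) / (A * Nat.sqrt n) with ht
      have ht0 : 0 ≤ t := by
        have : 0 ≤ Real.log (8 / δ) := Real.log_nonneg ((one_le_div hδ₀).2 (by linarith))
        positivity
      have hr₀ : t < (⌊t⌋₊ + 1 : ℕ) := by
        push_cast
        exact Nat.lt_floor_add_one t
      have hδ : 2 * Real.exp (-(a * γ / 2) * (⌊t⌋₊ + 1 : ℕ)) < δ / 4 := by
        have h1 : a * γ / 2 = A * Nat.sqrt n := by rw [ha, hA]; ring
        have h2 : Real.log (8 / δ) < A * Nat.sqrt n * (⌊t⌋₊ + 1 : ℕ) := by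
          rw [ht, div_lt_iff₀ (by positivity)] at hr₀
          linarith
        have h3 : Real.exp (-(a * γ / 2) * (⌊t⌋₊ + 1 : ℕ)) < δ / 8 := by
          rw [← Real.lt_log_iff_exp_lt (by positivity), h1, ← inv_div, Real.log_inv]
          linarith
        linarith
      have hmain := FLiBO.probGreater_fliboRegret_le hσ hα₀ hα₁ hcκ hthr₀ hthr₁
        (Nat.sqrt_le_self n) hN hφm hk hB hf hβ hfB hβ₁ hV hE hind hVE hcomp horacle hsolve
        (a := a) (by positivity) (by change 2 ≤ a * γ; rw [ha]; linarith) (by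
          have : τ ^ 2 * Nat.sqrt n / (128 * σ ^ 2) = 2 * a := by rw [ha, hA₀]; ring
          linarith)
        (Nat.succ_pos ⌊t⌋₊) hδ
      have hcost := fun t' => FLiBO.cost_le_excessRate (t := t') hB hδ₀ hδ₁ hA' hm hp hn
      constructor
      · obtain ⟨G, hG, hqG, hPG⟩ := hmain (fun s => s.val + 1) fun s => s.isLt
        refine ⟨G, hG, hqG, fun ω hω => ?_⟩
        -- The client's own vote leaves at most `⌊t⌋₊ ≤ t` tasks with too few votes.
        have hcard : ((Finset.univ.filter fun s : Fin m => s.val + 1 < ⌊t⌋₊ + 1).card : ℝ) ≤ t :=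
          (Nat.cast_le.2 (FLiBO.card_filter_val_add_lt_le 1)).trans (Nat.floor_le ht0)
        linarith [hPG ω hω, hcost _ hcard]
      · obtain ⟨G, hG, hqG, hPG⟩ := hmain (fun s => s.val) fun s => s.isLt.le
        refine ⟨G, hG, hqG, fun ω hω => ?_⟩
        -- Without the own vote there may be `⌊t⌋₊ + 1` such tasks, and the additional one costs `2
        -- * B * n`.
        have hcard : ((Finset.univ.filter fun s : Fin m => s.val < ⌊t⌋₊ + 1).card : ℝ) ≤
            t + 1 := by
          have h1 : ((Finset.univ.filter fun s : Fin m => s.val < ⌊t⌋₊ + 1).card : ℝ) ≤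
              (⌊t⌋₊ + 1 : ℕ) := Nat.cast_le.2 (FLiBO.card_filter_val_add_lt_le 0)
          push_cast at h1
          linarith [Nat.floor_le ht0]
        have h2 : 2 * B * n * ((Finset.univ.filter fun s : Fin m =>
            s.val < ⌊t⌋₊ + 1).card : ℝ) ≤ 2 * B * n * (t + 1) := by gcongr
        linarith [hPG ω hω, hcost t le_rfl]
  · intro p m B δ Rstar _ _ _ hR
    exact hR.add ((FLiBO.excessRate_isLittleO B δ m p).const_mul_left _)
  · intro p n B δ hB hδ₀ hδ₁ hn
    exact FLiBO.not_tendsto_excessRate_div (by positivity) hB hδ₀ hδ₁ hn p
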